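/- **Conventions.** Permutations act on the right: $x\cdot g$ or $xg$ is the image of $x$ under $g$, $gh$ means first $g$, then $h$, and $g^h=h^{-1}gh$. All rings are commutative with $1$. **Local Moufang sets.** A *local Moufang set* $\mathbb M$ consists of a set with an equivalence relation $(X,\sim)$ having more than two classes, and a subgroup $U_x$ of the group $\mathrm{Sym}(X,\sim)$ of equivalence-preserving permutations for every $x\in X$, such that, with $\overline x$ the class of $x$, $\overline X=X/{\sim}$, $U_{\overline x}$ the permutation group induced by $U_x$ on $\overline X$, and $G=\langle U_x\mid x\in X\rangle$: * (LM1) if $x\sim y$, then $U_{\overline x}=U_{\overline y}$; * (LM2) $U_x$ fixes $x$ and acts sharply transitively on $X\setminus\overline x$; * (LM2') $U_{\overline x}$ fixes $\overline x$ and acts sharply transitively on $\overline X\setminus\{\overline x\}$; * (LM3) $U_x^g=U_{xg}$ for all $x\in X$, $g\in G$. An *isomorphism* $\mathbb M\to\mathbb M'$ is a bijection $\phi:X\to X'$ with group isomorphisms $\theta_x:U_x\to U'_{\phi(x)}$ such that $x\sim y\iff\phi(x)\sim'\phi(y)$ and $\phi(x\cdot u)=\phi(x)\cdot\theta_y(u)$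 for all $x,y\in X$, $u\in U_y$. Fix points $0\nsim\infty$ of $X$. For $x\nsim\infty$ let $\alpha_x$ be the unique element of $U_\infty$ mapping $0$ to $x$, and put $-x=0\cdot\alpha_x^{-1}$. A *unit* is a point $x$ with $x\nsim0$ and $x\nsim\infty$. For a unit $x$, the *$\mu$-map* $\mu_x$ is the unique element of $U_0\alpha_xU_0$ that interchanges $0$ and $\infty$. The *Hua subgroup* is $H=\langle\mu_x\mu_y\mid x,y\text{ units}\rangle$. Fix a $\mu$-map $\tau$. For a unit $x$ write ${\sim}x=(-(x\tau^{-1}))\tau$ (this does not depend on $\tau$). Consider the conditions * (R1) $\mathbb M$ is special: ${\sim}x=-x$ for all units $x$; * (R2) $U_\infty$ is abelian; * (R3) $H$ is abelian; * (R4) if $x$ is a unit, then so is $x\cdot2:=x\alpha_x$. **The ring $R$.** Assume (R1)–(R4) and choose a unit $e$. On the set $R=X\setminus\overline\infty$ define $x+y=0\cdot\alpha_x\alpha_y$; this makes $R$ a uniquely $2$-divisible abelian group with zero $0$ and negatives $-x$. Put $h_x=\mu_e\mu_x$ for units $x$ and, for $x,y\in R$, $$xR_y=\begin{cases}x h_{e+y}-x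 h_y-x & \text{if } y \text{ and } y+e \text{ are units},\\ -x h_{-e+y}+x+x h_y & \text{if } y \text{ is a unit and } y+e \text{ is not},\\ x h_{2e+y}-x h_{e+y}-x h_{-2e}+x & \text{if } y \text{ is not a unit.}\end{cases}$$ Define $xy$ as the unique element of $R$ with $xy+xy=xR_y$. **The local Moufang set $\mathbb M(R)$.** For a local ring $R$ with maximal ideal $\mathfrak m$, let $\mathbb P^1(R)$ be the set of vector lines $[a,b]=\{(au,bu)\mid u\in R^\times\}$ with $aR+bR=R$, and let $[a,b]\sim[c,d]$ if and only if $ad-bc\in\mathfrak m$; equivalently, $[1,r]\sim[1,s]\iff r-s\in\mathfrak m$, all $[m,1]$ with $m\in\mathfrak m$ are equivalent to one another, and there are no other equivalences. The group $\mathsf{PSL}_2(R)$, the quotient of $\mathrm{SL}_2(R)$ by the scalar matrices it contains, acts on $\mathbb P^1(R)$ by right multiplication on row vectors. The root groups of $\mathbb M(R)$ are as follows. Let $0=[1,0]$, $\infty=[0,1]$, $$U_\infty=\left\{\begin{bmatrix}1&r\\0&1\end{bmatrix}\,\middle|\,r\in R\right\},\quad \tau'=\begin{bmatrix}0&1\\-1&0\end{bmatrix},\quad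 U_0=U_\infty^{\tau'}.$$ With $\alpha_p$ the element of $U_\infty$ mapping $0$ to $p$ (for $p\nsim\infty$), put $U_p=U_0^{\alpha_p}$ for $p\nsim\infty$, and $U_p=U_\infty^{g}$ with $g=(\alpha_{p\tau'^{-1}})^{\tau'}$ for $p\sim\infty$. **Theorem.** Let $\mathbb M$ be a local Moufang set with fixed points $0\nsim\infty$ that satisfies (R1)–(R4), let $e$ be a unit, and let $R_x$ be as above. Assume furthermore that $$x\mu_e\alpha_y=yR_x\alpha_{-2e}\mu_eR_x\mu_e\qquad\text{for all }x\sim0\text{ and }y\nsim\infty.$$ Then $R=X\setminus\overline\infty$, with the addition and multiplication above, is a local ring with identity element $e$, and $\mathbb M$ is isomorphic to $\mathbb M(R)$. -/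

import Mathlib

noncomputable section

namespace LMS

universe u v

/-! ## Sets with an equivalence relation and families of root groups

Permutations act on the left in Mathlib.  The right action `x · g` of the mathematics is written
`g • x`, the product `g h` ("first `g`, then `h`") is written `h * g`, and the conjugate
`h⁻¹ g h` ("first `h⁻¹`, then `g`, then `h`") is written `h * g * h⁻¹ = MulAut.conj h g`. -/

/-- `Sym(X, ∼)`: the group of equivalence-preserving permutations of `X`. -/
def SymRel {X : Type u} (r : Setoid X) : Subgroup (Equiv.Perm X) where
  carrier := {g | ∀ x y, r x y ↔ r (g x) (g y)}
  one_mem' := fun _ _ => Iff.rfl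
  mul_mem' := fun {_ b} ha hb x y => (hb x y).trans (ha (b x) (b y))
  inv_mem' := fun {a} ha x y => by
    have h := ha (a⁻¹ x) (a⁻¹ y)
    have e : ∀ z, a (a⁻¹ z) = z := fun z => a.apply_symm_apply z
    rw [e, e] at h
    exact h.symm

/-- The permutation `ḡ` of the set of equivalence classes that is induced by `g ∈ Sym(X, ∼)`. -/
def bar {X : Type u} (r : Setoid X) : SymRel r →* Equiv.Perm (Quotient r) where
  toFun g := Quotient.congr (g : Equiv.Perm X) (fun x y => g.2 x y)
  map_one' := by
    ext q
    induction q using Quotient.inductionOn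
    rfl
  map_mul' a b := by
    ext q
    induction q using Quotient.inductionOn
    rfl

/-- The conjugate `H^g = g⁻¹ H g` (right-action convention) of a subgroup. -/
def conjSubgroup {G : Type u} [Group G] (H : Subgroup G) (g : G) : Subgroup G :=
  H.map (MulAut.conj g).toMonoidHom

/-- A set with an equivalence relation and a family of subgroups `U_x ≤ Sym(X, ∼)`, `x ∈ X`.
This is only the underlying data, on which isomorphisms are defined;
see `LocalMoufangSet` for the axioms. -/
structure RootGroupData (X : Type u) where
  rel : Setoid X
  U : X → Subgroup (SymRel rel)

namespace RootGroupData

variable {X : Type u} (M : RootGroupData X)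

/-- The little projective group `G = ⟨U_x ∣ x ∈ X⟩`. -/
def littleProjectiveGroup : Subgroup (SymRel M.rel) := ⨆ x, M.U x

/-- The group induced by `U_x` on the set of equivalence classes. -/
def Ubar (x : X) : Subgroup (Equiv.Perm (Quotient M.rel)) := (M.U x).map (bar M.rel)

end RootGroupData

/-- An isomorphism: a bijection `φ : X → Y` and group isomorphisms `θ_x : U_x → U'_{φ(x)}` such that
`φ` preserves and reflects the equivalence and `φ(x · u) = φ(x) · θ_y(u)` for `u ∈ U_y`. -/
structure Iso {X : Type u} {Y : Type v} (M : RootGroupData X) (N : RootGroupData Y) where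
  φ : X ≃ Y
  θ : ∀ x, M.U x ≃* N.U (φ x)
  rel_iff : ∀ x y, M.rel x y ↔ N.rel (φ x) (φ y)
  map_smul : ∀ (x y : X) (u : M.U y),
    φ ((u : SymRel M.rel) • x) = (θ y u : SymRel N.rel) • φ x

/-- Local Moufang sets. -/
structure LocalMoufangSet (X : Type u) extends RootGroupData X where
  /-- There are more than two equivalence classes. -/
  two_lt_card : 2 < ENat.card (Quotient rel)
  /-- (LM1) -/
  lm1 : ∀ x y, rel x y → toRootGroupData.Ubar x = toRootGroupData.Ubar y
  /-- (LM2): `U_x` fixes `x` and is sharply transitive on the complement of the class of `x`. -/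
  lm2 : ∀ x, (∀ u ∈ U x, u • x = x) ∧
    ∀ a b, ¬ rel a x → ¬ rel b x → ∃! u, u ∈ U x ∧ u • a = b
  /-- (LM2'): the induced group fixes the class of `x` and is sharply transitive on the
  other classes. -/
  lm2' : ∀ x : X, (∀ u ∈ toRootGroupData.Ubar x, u (Quotient.mk rel x) = Quotient.mk rel x) ∧
    ∀ a b, a ≠ Quotient.mk rel x → b ≠ Quotient.mk rel x →
      ∃! u, u ∈ toRootGroupData.Ubar x ∧ u a = b
  /-- (LM3): `U_x^g = U_{x·g}` for all `g ∈ G`. -/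
  lm3 : ∀ x, ∀ g ∈ toRootGroupData.littleProjectiveGroup, conjSubgroup (U x) g = U (g • x)

open Classical in
/-- The element of `U` mapping `o` to `x` (the identity if there is none).  It is only used where
such an element exists and is unique. -/
def translation {X : Type u} {r : Setoid X} (U : Subgroup (SymRel r)) (o x : X) : SymRel r :=
  if h : ∃ g, g ∈ U ∧ g • o = x then h.choose else 1

/-! ## Local Moufang sets with two fixed non-equivalent points `0` and `∞` -/

/-- A local Moufang set with two non-equivalent points `0` and `∞`. -/
structure PointedLocalMoufangSet (X : Type u) extends LocalMoufangSet X where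
  zero : X
  inf : X
  zero_not_rel_inf : ¬ rel zero inf

namespace PointedLocalMoufangSet

variable {X : Type u} (M : PointedLocalMoufangSet X)

/-- `x` is a unit if it is equivalent neither to `0` nor to `∞`. -/
def IsUnitPoint (x : X) : Prop := ¬ M.rel x M.zero ∧ ¬ M.rel x M.inf

/-- For `x ≁ ∞`, the unique element `α_x` of `U_∞` mapping `0` to `x`. -/
def α (x : X) : SymRel M.rel := translation (M.U M.inf) M.zero x

/-- `-x = 0 · α_x⁻¹`, for `x ≁ ∞`. -/
def neg (x : X) : X := (M.α x)⁻¹ • M.zero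

/-- `x + y = 0 · α_x α_y`, for `x, y ≁ ∞`. -/
def add (x y : X) : X := M.α y • M.α x • M.zero

/-- `m` is an element of the double coset `U_0 α_x U_0` that swaps `0` and `∞`. -/
def IsMu (x : X) (m : SymRel M.rel) : Prop :=
  (∃ g ∈ M.U M.zero, ∃ h ∈ M.U M.zero, m = h * M.α x * g) ∧
    m • M.zero = M.inf ∧ m • M.inf = M.zero

open Classical in
/-- The μ-map `μ_x` of a unit `x`: the unique element of `U_0 α_x U_0` that swaps `0` and `∞`. -/
def mu (x : X) : SymRel M.rel := if h : ∃ m, M.IsMu x m then h.choose else 1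

/-- The Hua subgroup `H = ⟨μ_x μ_y ∣ x, y units⟩`. -/
def huaSubgroup : Subgroup (SymRel M.rel) :=
  Subgroup.closure {g | ∃ x y, M.IsUnitPoint x ∧ M.IsUnitPoint y ∧ g = M.mu y * M.mu x}

/-- `∼x = (-(x τ⁻¹)) τ`, for a unit `x` and a μ-map `τ`. -/
def tilde (τ : SymRel M.rel) (x : X) : X := τ • M.neg (τ⁻¹ • x)

/-- The local Moufang set is special (`∼x = -x` for all units `x`), where `∼` is computed with
the μ-map `τ`. -/
def IsSpecial (τ : SymRel M.rel) : Prop := ∀ x, M.IsUnitPoint x → M.tilde τ x = M.neg x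

/-! ### The ring construction -/

/-- `x · h_y` for the Hua map `h_y = μ_e μ_y` (first `μ_e`, then `μ_y`). -/
def hua (e y x : X) : X := M.mu y • M.mu e • x

open Classical in
/-- `x R_y`, for `x, y ≁ ∞`, by the three cases
(I) `x h_{e+y} - x h_y - x` if `y` and `y + e` are units,
(II) `-(x h_{-e+y}) + x + x h_y` if `y` is a unit and `y + e` is not,
(III) `x h_{2e+y} - x h_{e+y} - x h_{-2e} + x` if `y` is not a unit. -/
def Rmap (e y x : X) : X :=
  if M.IsUnitPoint y then
    if M.IsUnitPoint (M.add y e) then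
      M.add (M.add (M.hua e (M.add e y) x) (M.neg (M.hua e y x))) (M.neg x)
    else
      M.add (M.add (M.neg (M.hua e (M.add (M.neg e) y) x)) x) (M.hua e y x)
  else
    M.add (M.add (M.add (M.hua e (M.add (M.add e e) y) x) (M.neg (M.hua e (M.add e y) x)))
      (M.neg (M.hua e (M.neg (M.add e e)) x))) x

open Classical in
/-- `z / 2`: the unique `y ≁ ∞` with `y + y = z`, for `z ≁ ∞`. -/
def half (z : X) : X := if h : ∃ y, ¬ M.rel y M.inf ∧ M.add y y = z then h.choose else z

/-- `x y = (x R_y) / 2`, for `x, y ≁ ∞`. -/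
def mul (e x y : X) : X := M.half (M.Rmap e y x)

/-- The carrier `R = X ∖ ∞̄` of the ring. -/
def Carrier : Type u := {x : X // ¬ M.rel x M.inf}

/-- The point of `X` underlying an element of `R`. -/
def Carrier.pt {M : PointedLocalMoufangSet X} (x : M.Carrier) : X := x.1

end PointedLocalMoufangSet

/-! ## The construction `M(U, τ)` -/

open Classical in
/-- The family of root groups `M(U, τ)`.  With `0 = ∞ · τ`, `U_∞ = U`, `U_0 = U^τ`, `α_x` the
element of `U` mapping `0` to `x`, and `γ_x = α_x^τ = τ⁻¹ α_x τ`, the root groups are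
`U_x = U_0^{α_x}` for `x ≁ ∞` and `U_x = U_∞^{γ_{x τ⁻¹}}` for `x ∼ ∞`. -/
def ofRootGroup {X : Type u} (r : Setoid X) (U : Subgroup (SymRel r)) (τ : SymRel r) (inf : X) :
    RootGroupData X where
  rel := r
  U x :=
    if r x inf then
      conjSubgroup U (τ * translation U (τ • inf) (τ⁻¹ • x) * τ⁻¹)
    else
      conjSubgroup (conjSubgroup U τ) (translation U (τ • inf) x)

/-! ## The projective line over a local ring and `M(R)` -/

section ProjectiveLine

variable (R : Type u) [CommRing R]

/-- Pairs `(a, b) ∈ R²` with `aR + bR = R`. -/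
def UnimodularPair : Type u := {v : Fin 2 → R // IsCoprime (v 0) (v 1)}

/-- Two pairs span the same vector line if they differ by an invertible factor. -/
def lineSetoid : Setoid (UnimodularPair R) where
  r v w := ∃ c : Rˣ, w.1 = (c : R) • v.1
  iseqv :=
    { refl := fun v => ⟨1, by simp⟩
      symm := fun {v w} ⟨c, hc⟩ => ⟨c⁻¹, by rw [hc, smul_smul]; simp⟩
      trans := fun {u v w} ⟨c, hc⟩ ⟨d, hd⟩ => ⟨d * c, by rw [hd, hc, smul_smul]; simp⟩ }

/-- The projective line `P¹(R) = {[a, b] ∣ aR + bR = R}`. -/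
def ProjLine : Type u := Quotient (lineSetoid R)

variable {R}

/-- The point `[a, b]` of the projective line. -/
def ProjLine.mk (a b : R) (h : IsCoprime a b) : ProjLine R :=
  Quotient.mk (lineSetoid R) ⟨![a, b], h⟩

/-- The determinant `a d - b c` of two pairs `(a, b)` and `(c, d)`. -/
def pairDet (v w : UnimodularPair R) : R := v.1 0 * w.1 1 - v.1 1 * w.1 0

variable (R) in
/-- `[a, b] ∼ [c, d]` if and only if `a d - b c` lies in the maximal ideal.  See
`projRel_one_one`, `projRel_max_max` and `not_projRel_one_max` for what this says in terms of the
normal forms `[1, r]` and `[m, 1]` with `m` in the maximal ideal. -/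
def projRel [IsLocalRing R] : Setoid (ProjLine R) where
  r p q := Quotient.liftOn₂ p q (fun v w => pairDet v w ∈ IsLocalRing.maximalIdeal R) (by
    rintro v w v' w' ⟨c, hc⟩ ⟨d, hd⟩
    have h : pairDet v' w' = ((c * d : Rˣ) : R) * pairDet v w := by
      simp only [pairDet, hc, hd, Pi.smul_apply, smul_eq_mul, Units.val_mul]
      ring
    rw [h, eq_iff_iff]
    exact (Ideal.unit_mul_mem_iff_mem _ (c * d).isUnit).symm)
  iseqv :=
    { refl := fun p => by
        induction p using Quotient.inductionOn with | _ v =>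
        show pairDet v v ∈ _
        have h : pairDet v v = 0 := by simp only [pairDet]; ring
        rw [h]; exact zero_mem _
      symm := fun {p q} => by
        induction p using Quotient.inductionOn with | _ v =>
        induction q using Quotient.inductionOn with | _ w =>
        intro h
        have h' : pairDet w v = - pairDet v w := by simp only [pairDet]; ring
        show pairDet w v ∈ _
        rw [h']; exact neg_mem h
      trans := fun {p q s} => by
        induction p using Quotient.inductionOn with | _ v =>
        induction q using Quotient.inductionOn with | _ w =>
        induction s using Quotient.inductionOn with | _ z =>
        intro h₁ h₂
        obtain ⟨a, b, hab⟩ := w.2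
        have h' : pairDet v z = (a * z.1 0 + b * z.1 1) * pairDet v w
            + (a * v.1 0 + b * v.1 1) * pairDet w z := by
          simp only [pairDet]
          linear_combination (-(v.1 0 * z.1 1 - v.1 1 * z.1 0)) * hab
        show pairDet v z ∈ _
        rw [h']
        exact add_mem (Ideal.mul_mem_left _ _ h₁) (Ideal.mul_mem_left _ _ h₂) }

theorem projRel_one_one [IsLocalRing R] (r s : R) :
    projRel R (ProjLine.mk 1 r isCoprime_one_left) (ProjLine.mk 1 s isCoprime_one_left) ↔
      r - s ∈ IsLocalRing.maximalIdeal R := by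
  show (1 * s - r * 1 ∈ IsLocalRing.maximalIdeal R) ↔ _
  rw [← neg_mem_iff]
  simp

theorem projRel_max_max [IsLocalRing R] {m n : R} (hm : m ∈ IsLocalRing.maximalIdeal R)
    (hn : n ∈ IsLocalRing.maximalIdeal R) :
    projRel R (ProjLine.mk m 1 isCoprime_one_right) (ProjLine.mk n 1 isCoprime_one_right) := by
  show m * 1 - 1 * n ∈ IsLocalRing.maximalIdeal R
  simpa using sub_mem hm hn

theorem not_projRel_one_max [IsLocalRing R] (r : R) {m : R}
    (hm : m ∈ IsLocalRing.maximalIdeal R) :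
    ¬ projRel R (ProjLine.mk 1 r isCoprime_one_left) (ProjLine.mk m 1 isCoprime_one_right) := by
  show ¬ (1 * 1 - r * m ∈ IsLocalRing.maximalIdeal R)
  intro h
  have h1 := add_mem h (Ideal.mul_mem_left _ r hm)
  simp at h1

/-- Right multiplication `(a, b) ↦ (a, b) A` of a unimodular row by a matrix in `SL₂(R)`. -/
def rowMul (A : Matrix.SpecialLinearGroup (Fin 2) R) (v : UnimodularPair R) : UnimodularPair R :=
  ⟨Matrix.vecMul v.1 A.1, by
    obtain ⟨x, y, h⟩ := v.2
    have hd := A.2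
    rw [Matrix.det_fin_two] at hd
    refine ⟨x * A.1 1 1 - y * A.1 0 1, y * A.1 0 0 - x * A.1 1 0, ?_⟩
    simp only [Matrix.vecMul, dotProduct, Fin.sum_univ_two]
    linear_combination (x * v.1 0 + y * v.1 1) * hd + h⟩

/-- The map `[a, b] ↦ [(a, b) A]` of the projective line. -/
def lineMul (A : Matrix.SpecialLinearGroup (Fin 2) R) : ProjLine R → ProjLine R :=
  Quotient.map' (rowMul A) (by
    rintro v w ⟨c, hc⟩
    exact ⟨c, by simp only [rowMul, hc, Matrix.smul_vecMul]⟩)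

theorem lineMul_one (p : ProjLine R) : lineMul 1 p = p := by
  induction p using Quotient.inductionOn with | _ v =>
  exact congrArg (Quotient.mk (lineSetoid R)) (Subtype.ext (Matrix.vecMul_one v.1))

theorem lineMul_mul (A B : Matrix.SpecialLinearGroup (Fin 2) R) (p : ProjLine R) :
    lineMul (A * B) p = lineMul B (lineMul A p) := by
  induction p using Quotient.inductionOn with | _ v =>
  exact congrArg (Quotient.mk (lineSetoid R))
    (Subtype.ext (Matrix.vecMul_vecMul v.1 A.1 B.1).symm)

theorem projRel_lineMul [IsLocalRing R] (A : Matrix.SpecialLinearGroup (Fin 2) R)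
    (p q : ProjLine R) : projRel R p q ↔ projRel R (lineMul A p) (lineMul A q) := by
  induction p using Quotient.inductionOn with | _ v =>
  induction q using Quotient.inductionOn with | _ w =>
  show pairDet v w ∈ IsLocalRing.maximalIdeal R ↔
    pairDet (rowMul A v) (rowMul A w) ∈ IsLocalRing.maximalIdeal R
  have hd := A.2
  rw [Matrix.det_fin_two] at hd
  have h : pairDet (rowMul A v) (rowMul A w) = pairDet v w := by
    simp only [pairDet, rowMul, Matrix.vecMul, dotProduct, Fin.sum_univ_two]
    linear_combination (v.1 0 * w.1 1 - v.1 1 * w.1 0) * hd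
  rw [h]

variable (R) in
/-- The right action of `SL₂(R)` on the projective line, as a homomorphism to the opposite group of
`Sym(P¹(R), ∼)`. -/
def slAction [IsLocalRing R] :
    Matrix.SpecialLinearGroup (Fin 2) R →* (SymRel (projRel R))ᵐᵒᵖ where
  toFun A := MulOpposite.op
    ⟨{ toFun := lineMul A
       invFun := lineMul A⁻¹
       left_inv := fun p => by rw [← lineMul_mul, mul_inv_cancel, lineMul_one]
       right_inv := fun p => by rw [← lineMul_mul, inv_mul_cancel, lineMul_one] },
     fun p q => projRel_lineMul A p q⟩
  map_one' := by
    apply MulOpposite.unop_injective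
    ext p
    exact lineMul_one p
  map_mul' A B := by
    apply MulOpposite.unop_injective
    ext p
    exact lineMul_mul A B p

variable (R) in
/-- The right action of `PSL₂(R)` (the quotient of `SL₂(R)` by its center, which consists of the
scalar matrices `r I` with `r² = 1`) on the projective line. -/
def pslAction [IsLocalRing R] :
    Matrix.ProjectiveSpecialLinearGroup (Fin 2) R →* (SymRel (projRel R))ᵐᵒᵖ :=
  QuotientGroup.lift (Subgroup.center (Matrix.SpecialLinearGroup (Fin 2) R)) (slAction R) (by
    intro A hA
    obtain ⟨r, hr, hA⟩ := Matrix.SpecialLinearGroup.mem_center_iff.1 hA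
    have hr' : r * r = 1 := by simpa [sq] using hr
    apply MulOpposite.unop_injective
    ext p
    induction p using Quotient.inductionOn with | _ v =>
    refine Quotient.sound (s := lineSetoid R) ⟨⟨r, r, hr', hr'⟩, ?_⟩
    have h : (rowMul A v).1 = r • v.1 := by
      show Matrix.vecMul v.1 A.1 = _
      rw [← hA]
      ext i
      fin_cases i <;> simp [Matrix.vecMul, dotProduct, Matrix.diagonal, mul_comm]
    rw [h, smul_smul]
    simp [hr'])

/-- The permutation `p ↦ p · [A]` of the projective line, for `[A] ∈ PSL₂(R)`. -/
def pslPerm [IsLocalRing R] (A : Matrix.SpecialLinearGroup (Fin 2) R) : SymRel (projRel R) :=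
  (pslAction R (A : Matrix.ProjectiveSpecialLinearGroup (Fin 2) R)).unop

/-- The matrix `(1 r; 0 1)`. -/
def upperUnipotent (r : R) : Matrix.SpecialLinearGroup (Fin 2) R :=
  ⟨!![1, r; 0, 1], by simp [Matrix.det_fin_two]⟩

theorem upperUnipotent_add (r s : R) :
    upperUnipotent (r + s) = upperUnipotent r * upperUnipotent s := by
  apply Subtype.ext
  show !![1, r + s; 0, 1] = !![1, r; 0, 1] * !![1, s; 0, 1]
  simp [add_comm]

theorem upperUnipotent_zero : upperUnipotent (0 : R) = 1 := by
  apply Subtype.ext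
  ext i j
  fin_cases i <;> fin_cases j <;> simp [upperUnipotent]

variable (R) in
/-- The matrix `(0 1; -1 0)`. -/
def weylMatrix : Matrix.SpecialLinearGroup (Fin 2) R :=
  ⟨!![0, 1; -1, 0], by simp [Matrix.det_fin_two]⟩

theorem pslPerm_mul [IsLocalRing R] (A B : Matrix.SpecialLinearGroup (Fin 2) R) :
    pslPerm (A * B) = pslPerm B * pslPerm A := by
  simp only [pslPerm, QuotientGroup.mk_mul, map_mul, MulOpposite.unop_mul]

theorem pslPerm_one [IsLocalRing R] :
    pslPerm (1 : Matrix.SpecialLinearGroup (Fin 2) R) = 1 := by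
  simp only [pslPerm, QuotientGroup.mk_one, map_one, MulOpposite.unop_one]

variable (R) in
/-- The root group `U_{[0,1]} = {[1 r; 0 1] ∣ r ∈ R}` of `PSL₂(R)`, acting on the projective
line. -/
def upperRootGroup [IsLocalRing R] : Subgroup (SymRel (projRel R)) where
  carrier := {g | ∃ r : R, g = pslPerm (upperUnipotent r)}
  one_mem' := ⟨0, by rw [upperUnipotent_zero, pslPerm_one]⟩
  mul_mem' := by
    rintro _ _ ⟨r, rfl⟩ ⟨s, rfl⟩
    exact ⟨s + r, by rw [upperUnipotent_add, pslPerm_mul]⟩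
  inv_mem' := by
    rintro _ ⟨r, rfl⟩
    refine ⟨-r, ?_⟩
    rw [inv_eq_iff_mul_eq_one, ← pslPerm_mul, ← upperUnipotent_add, neg_add_cancel,
      upperUnipotent_zero, pslPerm_one]

variable (R) in
/-- `M(R) = M(U, τ)` with `U = {[1 r; 0 1] ∣ r ∈ R}`, `τ = [0 1; -1 0]` and `∞ = [0, 1]`. -/
def projMoufang [IsLocalRing R] : RootGroupData (ProjLine R) :=
  ofRootGroup (projRel R) (upperRootGroup R) (pslPerm (weylMatrix R))
    (ProjLine.mk 0 1 isCoprime_one_right)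

end ProjectiveLine

end LMS

end

noncomputable section

namespace LMS

namespace PointedLocalMoufangSet

universe u

variable {X : Type u} (M : PointedLocalMoufangSet X)

/-! ## Root groups, translations and μ-maps -/

/-! Speciality says that inversion in `U_0` is again `x ↦ -x` (`inv_β_of_isSpecial`), so every
element of `G` interchanging `0` and `∞` is odd on units. Together with the closure of units under
doubling, this makes each μ-map an involution (`mu_mul_self`) and forces unique halves
(`swapApp_double`).

The ring comes from one identity. Since `U_0` is abelian, comparing the two orders of a product of
two of its elements at `∞` yields a sum formula for μ-maps (`swapApp_mu_sub_swapApp_mu`).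
Specialized, it says that `u ↦ e h_u` has the same differences as squaring: `e h_{v+e} - e h_v = 2v
+ e`. Hence in all three cases of its definition `R_y` sends `e` to `2y` (`exists_Rmap_eq`).
Moreover `R_y` is an integer combination of Hua maps, so it lies in the ring of endomorphisms
generated by the Hua subgroup, which is commutative. Commutativity and associativity of the product
follow by letting commuting operators act on `e`, and every operator in that ring is multiplication
by its value at `e` (`endo_apply`). The sum formula then also shows that `μ_e` is `u ↦ -u⁻¹`
(`swapApp_mu_one_mul`). So the noninvertible elements are exactly the class of `0`, which is an
additive subgroup, and the ring is local.

For the isomorphism, all root groups are determined by `U_∞` and one element interchanging `0` and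
`∞` (`map_U_eq`), so it suffices to match `U_∞` and `μ_e` with matrices. The results so far give the
whole action of `μ_e` and the action of `U_∞` away from the class of `∞`. The extra assumption
supplies the rest: it reads `z μ_e α_y = (z(1 - zy)⁻¹) μ_e` for `z ∼ 0` (`α_smul_weyl_smul`), which
is the action of a unipotent matrix on `[-z, 1]`. -/

theorem rel_smul_iff (g : SymRel M.rel) {x y : X} : M.rel (g • x) (g • y) ↔ M.rel x y :=
  (g.2 x y).symm

theorem mem_littleProjectiveGroup {p : X} {g : SymRel M.rel} (hg : g ∈ M.U p) :
    g ∈ M.littleProjectiveGroup :=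
  (le_iSup M.U p) hg

theorem smul_fixed {p : X} {g : SymRel M.rel} (hg : g ∈ M.U p) : g • p = p :=
  (M.lm2 p).1 g hg

theorem conj_mem {p : X} {g u : SymRel M.rel} (hg : g ∈ M.littleProjectiveGroup)
    (hu : u ∈ M.U p) : g * u * g⁻¹ ∈ M.U (g • p) := by
  rw [← M.lm3 p g hg]
  exact ⟨u, hu, rfl⟩

theorem translation_mem {p a b : X} (ha : ¬ M.rel a p) (hb : ¬ M.rel b p) :
    translation (M.U p) a b ∈ M.U p := by
  obtain ⟨g, hg, -⟩ := (M.lm2 p).2 a b ha hb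
  have h : ∃ g, g ∈ M.U p ∧ g • a = b := ⟨g, hg⟩
  rw [translation, dif_pos h]
  exact h.choose_spec.1

theorem translation_smul {p a b : X} (ha : ¬ M.rel a p) (hb : ¬ M.rel b p) :
    translation (M.U p) a b • a = b := by
  obtain ⟨g, hg, -⟩ := (M.lm2 p).2 a b ha hb
  have h : ∃ g, g ∈ M.U p ∧ g • a = b := ⟨g, hg⟩
  rw [translation, dif_pos h]
  exact h.choose_spec.2

theorem not_rel_smul {p a : X} {g : SymRel M.rel} (hg : g ∈ M.U p) (ha : ¬ M.rel a p) :
    ¬ M.rel (g • a) p :=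
  fun h => ha ((M.rel_smul_iff g).1 (by rwa [M.smul_fixed hg]))

theorem eq_translation {p a b : X} {g : SymRel M.rel} (ha : ¬ M.rel a p) (hg : g ∈ M.U p)
    (h : g • a = b) : g = translation (M.U p) a b := by
  have hb : ¬ M.rel b p := h ▸ M.not_rel_smul hg ha
  exact ((M.lm2 p).2 a b ha hb).unique ⟨hg, h⟩
    ⟨M.translation_mem ha hb, M.translation_smul ha hb⟩

theorem inf_not_rel_zero : ¬ M.rel M.inf M.zero := fun h => M.zero_not_rel_inf (M.rel.symm h)

/-- The element of `U_0` mapping `∞` to `c`. -/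
def β (c : X) : SymRel M.rel := translation (M.U M.zero) M.inf c

variable {M} {x y : X} {g : SymRel M.rel}

theorem α_mem (hx : ¬ M.rel x M.inf) : M.α x ∈ M.U M.inf :=
  M.translation_mem M.zero_not_rel_inf hx

theorem α_smul_zero (hx : ¬ M.rel x M.inf) : M.α x • M.zero = x :=
  M.translation_smul M.zero_not_rel_inf hx

theorem eq_α (hg : g ∈ M.U M.inf) (h : g • M.zero = x) : g = M.α x :=
  M.eq_translation M.zero_not_rel_inf hg h

theorem β_mem (hx : ¬ M.rel x M.zero) : M.β x ∈ M.U M.zero :=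
  M.translation_mem M.inf_not_rel_zero hx

theorem β_smul_inf (hx : ¬ M.rel x M.zero) : M.β x • M.inf = x :=
  M.translation_smul M.inf_not_rel_zero hx

theorem eq_β (hg : g ∈ M.U M.zero) (h : g • M.inf = x) : g = M.β x :=
  M.eq_translation M.inf_not_rel_zero hg h

theorem neg_not_rel_inf (hx : ¬ M.rel x M.inf) : ¬ M.rel (M.neg x) M.inf :=
  M.not_rel_smul (inv_mem (α_mem hx)) M.zero_not_rel_inf

theorem α_neg (hx : ¬ M.rel x M.inf) : M.α (M.neg x) = (M.α x)⁻¹ :=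
  (eq_α (inv_mem (α_mem hx)) rfl).symm

theorem α_smul_not_rel_inf (hx : ¬ M.rel x M.inf) (hy : ¬ M.rel y M.inf) :
    ¬ M.rel (M.α y • x) M.inf :=
  M.not_rel_smul (α_mem hy) hx

theorem add_eq (hx : ¬ M.rel x M.inf) : M.add x y = M.α y • x := by
  rw [add, α_smul_zero hx]

theorem α_add (hx : ¬ M.rel x M.inf) (hy : ¬ M.rel y M.inf) :
    M.α (M.add x y) = M.α y * M.α x :=
  (eq_α (mul_mem (α_mem hy) (α_mem hx)) (mul_smul _ _ _)).symm

theorem α_zero : M.α M.zero = 1 := (eq_α (one_mem _) (one_smul _ _)).symm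

theorem α_smul_neg (x : X) : M.α x • M.neg x = M.zero := by
  rw [neg, smul_inv_smul]

theorem neg_isUnitPoint (hx : M.IsUnitPoint x) : M.IsUnitPoint (M.neg x) := by
  refine ⟨fun h => hx.1 ?_, neg_not_rel_inf hx.2⟩
  have h1 := (M.rel_smul_iff (M.α x)).2 h
  rw [α_smul_neg x, α_smul_zero hx.2] at h1
  exact M.rel.symm h1

/-- Interchanging `0` and `∞` prescribes where both outer factors from `U_0` move `∞`, and sharp
transitivity then leaves one choice for each. This gives existence and uniqueness of the μ-map at
once. -/
theorem isMu_iff (hx : M.IsUnitPoint x) :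
    M.IsMu x g ↔ g = (M.β x)⁻¹ * M.α x * M.β (M.neg x) := by
  have hn := neg_isUnitPoint hx
  constructor
  · rintro ⟨⟨a, ha, b, hb, rfl⟩, h0, h1⟩
    have hb' : b⁻¹ = M.β x := by
      refine eq_β (inv_mem hb) ?_
      rw [← h0, mul_smul, mul_smul, inv_smul_smul, M.smul_fixed ha, α_smul_zero hx.2]
    have ha' : a = M.β (M.neg x) := by
      refine eq_β ha ?_
      rw [neg, eq_inv_smul_iff, ← smul_left_cancel_iff b, ← mul_smul, ← mul_smul, h1,
        M.smul_fixed hb]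
    rw [← ha', ← hb', inv_inv]
  · rintro rfl
    refine ⟨⟨_, β_mem hn.1, _, inv_mem (β_mem hx.1), rfl⟩, ?_, ?_⟩
    · rw [mul_smul, mul_smul, M.smul_fixed (β_mem hn.1), α_smul_zero hx.2, inv_smul_eq_iff,
        β_smul_inf hx.1]
    · rw [mul_smul, mul_smul, β_smul_inf hn.1, α_smul_neg x, inv_smul_eq_iff,
        M.smul_fixed (β_mem hx.1)]

theorem isMu_mu (hx : M.IsUnitPoint x) : M.IsMu x (M.mu x) := by
  have h : ∃ m, M.IsMu x m := ⟨_, (isMu_iff hx).2 rfl⟩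
  rw [mu, dif_pos h]
  exact h.choose_spec

theorem mu_eq (hx : M.IsUnitPoint x) : M.mu x = (M.β x)⁻¹ * M.α x * M.β (M.neg x) :=
  (isMu_iff hx).1 (isMu_mu hx)

/-! ### Elements interchanging `0` and `∞` -/

variable (M) in
/-- The elements of the little projective group that interchange `0` and `∞`. -/
structure IsSwap (g : SymRel M.rel) : Prop where
  mem : g ∈ M.littleProjectiveGroup
  smul_zero : g • M.zero = M.inf
  smul_inf : g • M.inf = M.zero

theorem IsSwap.inv (h : M.IsSwap g) : M.IsSwap g⁻¹ :=
  ⟨inv_mem h.mem, inv_smul_eq_iff.2 h.smul_inf.symm, inv_smul_eq_iff.2 h.smul_zero.symm⟩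

theorem isSwap_mu (hx : M.IsUnitPoint x) : M.IsSwap (M.mu x) := by
  refine ⟨?_, (isMu_mu hx).2.1, (isMu_mu hx).2.2⟩
  rw [mu_eq hx]
  exact mul_mem (mul_mem (inv_mem (M.mem_littleProjectiveGroup (β_mem hx.1)))
    (M.mem_littleProjectiveGroup (α_mem hx.2)))
    (M.mem_littleProjectiveGroup (β_mem (neg_isUnitPoint hx).1))

theorem IsSwap.rel_zero_iff (h : M.IsSwap g) : M.rel (g • x) M.zero ↔ M.rel x M.inf := by
  rw [← h.smul_inf, M.rel_smul_iff]

theorem IsSwap.rel_inf_iff (h : M.IsSwap g) : M.rel (g • x) M.inf ↔ M.rel x M.zero := by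
  rw [← h.smul_zero, M.rel_smul_iff]

theorem IsSwap.isUnitPoint (h : M.IsSwap g) (hx : M.IsUnitPoint x) : M.IsUnitPoint (g • x) :=
  ⟨fun h' => hx.2 (h.rel_zero_iff.1 h'), fun h' => hx.1 (h.rel_inf_iff.1 h')⟩

theorem IsSwap.conj_α (h : M.IsSwap g) (hx : ¬ M.rel x M.inf) :
    g * M.α x * g⁻¹ = M.β (g • x) := by
  refine eq_β ?_ ?_
  · have := M.conj_mem h.mem (α_mem hx)
    rwa [h.smul_inf] at this
  · rw [mul_smul, mul_smul, h.inv.smul_inf, α_smul_zero hx]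

theorem IsSwap.conj_β (h : M.IsSwap g) (hx : ¬ M.rel x M.zero) :
    g * M.β x * g⁻¹ = M.α (g • x) := by
  refine eq_α ?_ ?_
  · have := M.conj_mem h.mem (β_mem hx)
    rwa [h.smul_zero] at this
  · rw [mul_smul, mul_smul, h.inv.smul_zero, β_smul_inf hx]

/-- Conjugation by `μ_t⁻¹` carries `U_0` to `U_∞`, so `∼x` is the image of `∞` under the inverse of
`β_x`. Speciality identifies this image with `-x`. -/
theorem inv_β_of_isSpecial {t : X} (ht : M.IsUnitPoint t) (h : M.IsSpecial (M.mu t))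
    (hx : M.IsUnitPoint x) : (M.β x)⁻¹ = M.β (M.neg x) := by
  have hs := (isSwap_mu ht).inv
  have h1 := hs.conj_β hx.1
  refine eq_β (inv_mem (β_mem hx.1)) ?_
  rw [← h x hx, tilde, neg, ← h1, mul_inv_rev, mul_inv_rev, inv_inv, ← mul_smul]
  simp only [mul_inv_cancel_left]
  rw [inv_inv, mul_smul, (isSwap_mu ht).smul_zero]

/-! ### The stabilizer of `0` and `∞` in the little projective group -/

variable (M) in
/-- The elements of the little projective group that fix `0` and `∞`. -/
def torus : Subgroup (SymRel M.rel) where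
  carrier := {g | g ∈ M.littleProjectiveGroup ∧ g • M.zero = M.zero ∧ g • M.inf = M.inf}
  one_mem' := ⟨one_mem _, one_smul _ _, one_smul _ _⟩
  mul_mem' {a b} ha hb := ⟨mul_mem ha.1 hb.1, by rw [mul_smul, hb.2.1, ha.2.1],
    by rw [mul_smul, hb.2.2, ha.2.2]⟩
  inv_mem' {a} ha := ⟨inv_mem ha.1, by rw [inv_smul_eq_iff, ha.2.1],
    by rw [inv_smul_eq_iff, ha.2.2]⟩

theorem IsSwap.mul_mem_torus {m : SymRel M.rel} (hg : M.IsSwap g) (hm : M.IsSwap m) :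
    g * m ∈ M.torus :=
  ⟨mul_mem hg.mem hm.mem, by rw [mul_smul, hm.smul_zero, hg.smul_inf],
    by rw [mul_smul, hm.smul_inf, hg.smul_zero]⟩

theorem huaSubgroup_le_torus : M.huaSubgroup ≤ M.torus := by
  rw [huaSubgroup, Subgroup.closure_le]
  rintro _ ⟨x, y, hx, hy, rfl⟩
  exact (isSwap_mu hy).mul_mem_torus (isSwap_mu hx)

theorem torus_rel_inf {h : SymRel M.rel} (hh : h ∈ M.torus) {p : X} :
    M.rel (h • p) M.inf ↔ M.rel p M.inf := by
  conv_lhs => rw [← hh.2.2]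
  exact M.rel_smul_iff h

theorem torus_conj_α {h : SymRel M.rel} (hh : h ∈ M.torus) {p : X} (hp : ¬ M.rel p M.inf) :
    h * M.α p * h⁻¹ = M.α (h • p) := by
  refine eq_α ?_ ?_
  · have := M.conj_mem hh.1 (α_mem hp)
    rwa [hh.2.2] at this
  · have h1 : h⁻¹ • M.zero = M.zero := by rw [inv_smul_eq_iff, hh.2.1]
    rw [mul_smul, mul_smul, h1, α_smul_zero hp]

end PointedLocalMoufangSet
end LMS

namespace LMS

namespace PointedLocalMoufangSet

universe u

variable {X : Type u} {M : PointedLocalMoufangSet X}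

/-! ## The additive group `X ∖ ∞̄` -/

variable (M) in
/-- Special local Moufang sets with abelian root groups in which doubles of units are units. -/
class IsSpecialAbelian : Prop where
  comm : ∀ g ∈ M.U M.inf, ∀ h ∈ M.U M.inf, g * h = h * g
  inv_β : ∀ x, M.IsUnitPoint x → (M.β x)⁻¹ = M.β (M.neg x)
  double : ∀ x, M.IsUnitPoint x → M.IsUnitPoint (M.α x • x)

theorem Carrier.ext {x y : M.Carrier} (h : x.pt = y.pt) : x = y := Subtype.ext h

theorem Carrier.not_rel_inf (x : M.Carrier) : ¬ M.rel x.pt M.inf := x.2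

/-- The element of `X ∖ ∞̄` given by a point outside the class of `∞`. -/
def Carrier.mk (x : X) (h : ¬ M.rel x M.inf) : M.Carrier := ⟨x, h⟩

theorem add_not_rel_inf {x y : X} (hx : ¬ M.rel x M.inf) (hy : ¬ M.rel y M.inf) :
    ¬ M.rel (M.add x y) M.inf := by
  rw [add_eq hx]
  exact α_smul_not_rel_inf hx hy

scoped instance : Zero M.Carrier := ⟨.mk M.zero M.zero_not_rel_inf⟩

scoped instance : Add M.Carrier := ⟨fun x y => .mk (M.add x.pt y.pt)
  (add_not_rel_inf x.not_rel_inf y.not_rel_inf)⟩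

scoped instance : Neg M.Carrier := ⟨fun x => .mk (M.neg x.pt) (neg_not_rel_inf x.not_rel_inf)⟩

theorem pt_add (x y : M.Carrier) : (x + y).pt = M.add x.pt y.pt := rfl
theorem pt_neg (x : M.Carrier) : (-x).pt = M.neg x.pt := rfl
theorem pt_zero : (0 : M.Carrier).pt = M.zero := rfl

theorem α_smul_pt (x y : M.Carrier) : M.α y.pt • x.pt = (x + y).pt :=
  (add_eq x.not_rel_inf).symm

theorem α_pt_injective {x y : M.Carrier} (h : M.α x.pt = M.α y.pt) : x = y := by
  apply Carrier.ext
  rw [← α_smul_zero x.not_rel_inf, h, α_smul_zero y.not_rel_inf]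

open Classical in
variable (M) in
/-- The element of `X ∖ ∞̄` given by a point (with value `0` outside). -/
def toCarrier (x : X) : M.Carrier := if h : ¬ M.rel x M.inf then .mk x h else 0

theorem pt_toCarrier {x : X} (h : ¬ M.rel x M.inf) : (M.toCarrier x).pt = x := by
  rw [toCarrier, dif_pos h]; rfl

theorem rel_add_right_iff (x y z : M.Carrier) :
    M.rel (x + z).pt (y + z).pt ↔ M.rel x.pt y.pt := by
  rw [← α_smul_pt, ← α_smul_pt, M.rel_smul_iff]

theorem toCarrier_pt (x : M.Carrier) : M.toCarrier x.pt = x :=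
  Carrier.ext (pt_toCarrier x.not_rel_inf)

variable [IsSpecialAbelian M]

scoped instance : AddCommGroup M.Carrier where
  nsmul := nsmulRec
  zsmul := zsmulRec
  add_assoc x y z := by
    apply Carrier.ext
    show M.add (M.add x.pt y.pt) z.pt = M.add x.pt (M.add y.pt z.pt)
    rw [add_eq (add_not_rel_inf x.not_rel_inf y.not_rel_inf), add_eq x.not_rel_inf,
      add_eq x.not_rel_inf, α_add y.not_rel_inf z.not_rel_inf, mul_smul]
  zero_add x := Carrier.ext (by
    show M.add M.zero x.pt = x.pt
    rw [add_eq M.zero_not_rel_inf, α_smul_zero x.not_rel_inf])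
  add_zero x := Carrier.ext (by
    show M.add x.pt M.zero = x.pt
    rw [add_eq x.not_rel_inf, α_zero, one_smul])
  neg_add_cancel x := Carrier.ext (by
    show M.add (M.neg x.pt) x.pt = M.zero
    rw [add_eq (neg_not_rel_inf x.not_rel_inf), α_smul_neg])
  add_comm x y := Carrier.ext (by
    show M.add x.pt y.pt = M.add y.pt x.pt
    rw [add, add, ← mul_smul, ← mul_smul,
      IsSpecialAbelian.comm _ (α_mem x.not_rel_inf) _ (α_mem y.not_rel_inf)])

theorem α_inv_smul_pt (x y : M.Carrier) : (M.α y.pt)⁻¹ • x.pt = (x - y).pt := by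
  rw [sub_eq_add_neg, ← α_smul_pt, pt_neg, α_neg y.not_rel_inf]

variable (M) in
/-- The class of `0`, as a subgroup of the additive group. -/
def nonunits : AddSubgroup M.Carrier where
  carrier := {x | M.rel x.pt M.zero}
  zero_mem' := M.rel.refl _
  add_mem' {x y} hx hy := by
    refine M.rel.trans (b := y.pt) ?_ hy
    have := rel_add_right_iff x 0 y
    rw [zero_add] at this
    exact this.2 hx
  neg_mem' {x} hx := by
    have := rel_add_right_iff x 0 (-x)
    rw [zero_add, add_neg_cancel] at this
    exact M.rel.symm (this.2 hx)

theorem mem_nonunits {x : M.Carrier} : x ∈ M.nonunits ↔ M.rel x.pt M.zero := Iff.rfl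

theorem rel_iff_sub_mem {x y : M.Carrier} : M.rel x.pt y.pt ↔ x - y ∈ M.nonunits := by
  have := rel_add_right_iff x y (-y)
  rw [add_neg_cancel, ← sub_eq_add_neg] at this
  exact this.symm

theorem isUnitPoint_iff {x : M.Carrier} : M.IsUnitPoint x.pt ↔ x ∉ M.nonunits :=
  ⟨fun h => h.1, fun h => ⟨h, x.not_rel_inf⟩⟩

theorem double_mem_iff {x : M.Carrier} : x + x ∈ M.nonunits ↔ x ∈ M.nonunits := by
  refine ⟨fun h => ?_, fun h => add_mem h h⟩
  by_contra hx
  have := IsSpecialAbelian.double x.pt (isUnitPoint_iff.2 hx)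
  rw [α_smul_pt] at this
  exact this.1 h

theorem add_notMem_nonunits {x y : M.Carrier} (hx : x ∉ M.nonunits) (hy : y ∈ M.nonunits) :
    x + y ∉ M.nonunits := fun h => hx (by simpa using sub_mem h hy)

/-! ## The action of the swaps on units -/

/-- The action of a swap on the units of the additive group. -/
def swapApp (g : SymRel M.rel) (x : M.Carrier) : M.Carrier := M.toCarrier (g • x.pt)

variable {g : SymRel M.rel} {x y z : M.Carrier}

theorem pt_swapApp (hg : M.IsSwap g) (hx : x ∉ M.nonunits) : (swapApp g x).pt = g • x.pt :=
  pt_toCarrier (hg.isUnitPoint (isUnitPoint_iff.2 hx)).2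

theorem swapApp_notMem (hg : M.IsSwap g) (hx : x ∉ M.nonunits) : swapApp g x ∉ M.nonunits := by
  rw [← isUnitPoint_iff, pt_swapApp hg hx]
  exact hg.isUnitPoint (isUnitPoint_iff.2 hx)

theorem swapApp_inv_swapApp (hg : M.IsSwap g) (hx : x ∉ M.nonunits) :
    swapApp g⁻¹ (swapApp g x) = x := by
  rw [swapApp, pt_swapApp hg hx, inv_smul_smul, toCarrier_pt]

theorem swapApp_swapApp_inv (hg : M.IsSwap g) (hx : x ∉ M.nonunits) :
    swapApp g (swapApp g⁻¹ x) = x := by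
  rw [swapApp, pt_swapApp hg.inv hx, smul_inv_smul, toCarrier_pt]

theorem inv_β_pt (hx : x ∉ M.nonunits) : (M.β x.pt)⁻¹ = M.β (-x).pt :=
  IsSpecialAbelian.inv_β _ (isUnitPoint_iff.2 hx)

theorem neg_notMem (hx : x ∉ M.nonunits) : -x ∉ M.nonunits := by rwa [neg_mem_iff]

/-- A swap conjugates `β_x` to the translation by the image of `x`, and inversion on both sides is
negation of the label. -/
theorem swapApp_neg (hg : M.IsSwap g) (hx : x ∉ M.nonunits) :
    swapApp g (-x) = -swapApp g x := by
  apply α_pt_injective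
  rw [pt_swapApp hg (neg_notMem hx), ← hg.conj_β (neg_notMem hx), ← inv_β_pt hx, pt_neg,
    α_neg (Carrier.not_rel_inf _), pt_swapApp hg hx, ← hg.conj_β hx]
  group

theorem mu_eq_β_α_β (hx : x ∉ M.nonunits) :
    M.mu x.pt = M.β (-x).pt * M.α x.pt * M.β (-x).pt := by
  rw [mu_eq (isUnitPoint_iff.2 hx), inv_β_pt hx, pt_neg]

theorem isSwap_mu_pt (hx : x ∉ M.nonunits) : M.IsSwap (M.mu x.pt) :=
  isSwap_mu (isUnitPoint_iff.2 hx)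

theorem mu_smul_self (hx : x ∉ M.nonunits) : M.mu x.pt • x.pt = (-x).pt := by
  have h : M.β (-x).pt • x.pt = M.inf := by
    rw [← inv_β_pt hx, inv_smul_eq_iff, β_smul_inf hx]
  rw [mu_eq_β_α_β hx, mul_smul, mul_smul, h, M.smul_fixed (α_mem x.not_rel_inf),
    β_smul_inf (neg_notMem hx)]

theorem swapApp_mu_self (hx : x ∉ M.nonunits) : swapApp (M.mu x.pt) x = -x := by
  rw [swapApp, mu_smul_self hx, toCarrier_pt]

theorem mu_smul_neg_self (hx : x ∉ M.nonunits) : M.mu x.pt • (-x).pt = x.pt := by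
  rw [← pt_swapApp (isSwap_mu_pt hx) (neg_notMem hx), swapApp_neg (isSwap_mu_pt hx) hx,
    swapApp_mu_self hx, neg_neg]

theorem mu_neg (hx : x ∉ M.nonunits) : M.mu (-x).pt = (M.mu x.pt)⁻¹ := by
  rw [mu_eq_β_α_β hx, mu_eq_β_α_β (neg_notMem hx), ← inv_β_pt (neg_notMem hx), pt_neg x,
    α_neg x.not_rel_inf]
  group

theorem conj_mu_α (hx : x ∉ M.nonunits) :
    M.mu x.pt * M.α x.pt * (M.mu x.pt)⁻¹ = M.β (-x).pt := by
  rw [(isSwap_mu_pt hx).conj_α x.not_rel_inf, mu_smul_self hx]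

theorem conj_mu_β (hx : x ∉ M.nonunits) :
    M.mu x.pt * M.β (-x).pt * (M.mu x.pt)⁻¹ = M.α x.pt := by
  rw [(isSwap_mu_pt hx).conj_β (neg_notMem hx), mu_smul_neg_self hx]

/-- Conjugate `μ_x = β_{-x} α_x β_{-x}` by `μ_x` itself, which exchanges `α_x` and `β_{-x}`. -/
theorem mu_eq_α_β_α (hx : x ∉ M.nonunits) :
    M.mu x.pt = M.α x.pt * M.β (-x).pt * M.α x.pt := by
  have h : M.mu x.pt = (M.mu x.pt * M.β (-x).pt * (M.mu x.pt)⁻¹) *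
      (M.mu x.pt * M.α x.pt * (M.mu x.pt)⁻¹) * (M.mu x.pt * M.β (-x).pt * (M.mu x.pt)⁻¹) := by
    have h := mu_eq_β_α_β hx
    calc M.mu x.pt = M.mu x.pt * M.mu x.pt * (M.mu x.pt)⁻¹ := by group
      _ = M.mu x.pt * (M.β (-x).pt * M.α x.pt * M.β (-x).pt) * (M.mu x.pt)⁻¹ := by rw [← h]
      _ = _ := by group
  rwa [conj_mu_α hx, conj_mu_β hx] at h

theorem mu_eq_α_mu_α_mu_inv_α (hx : x ∉ M.nonunits) :
    M.mu x.pt = M.α x.pt * (M.mu x.pt * M.α x.pt * (M.mu x.pt)⁻¹) * M.α x.pt := by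
  rw [conj_mu_α hx]
  exact mu_eq_α_β_α hx

/-- Evaluates such a factorization of `g` at `y` inside the additive group. The inner argument must
be a unit, since otherwise the image of `y` under `g` would be equivalent to `∞`. -/
theorem swapApp_of_eq {m : SymRel M.rel} (hg : M.IsSwap g) (hm : M.IsSwap m)
    (h : g = M.α x.pt * (m * M.α x.pt * m⁻¹) * M.α x.pt) (hy : y ∉ M.nonunits)
    (hxy : y + x ∉ M.nonunits) :
    swapApp m⁻¹ (y + x) + x ∉ M.nonunits ∧
      swapApp g y = swapApp m (swapApp m⁻¹ (y + x) + x) + x := by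
  have h1 : g • y.pt = M.α x.pt • m • (swapApp m⁻¹ (y + x) + x).pt := by
    rw [← α_smul_pt, pt_swapApp hm.inv hxy, ← α_smul_pt, h]
    simp only [← mul_smul, mul_assoc]
  have h2 : swapApp m⁻¹ (y + x) + x ∉ M.nonunits := fun h0 =>
    (hg.isUnitPoint (isUnitPoint_iff.2 hy)).2 <| by
      rw [h1]
      have := (M.rel_smul_iff (M.α x.pt)).2 (hm.rel_inf_iff.2 h0)
      rwa [M.smul_fixed (α_mem x.not_rel_inf)] at this
  refine ⟨h2, Carrier.ext ?_⟩
  rw [pt_swapApp hg hy, h1, ← pt_swapApp hm h2, α_smul_pt]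

theorem swapApp_mu_inv_of_sub (hx : x ∉ M.nonunits) (hy : y ∉ M.nonunits)
    (hxy : y - x ∉ M.nonunits) : swapApp (M.mu x.pt)⁻¹ y = swapApp (M.mu x.pt) y := by
  have hm := isSwap_mu_pt hx
  have e := mu_eq_α_mu_α_mu_inv_α hx
  rw [sub_eq_add_neg] at hxy
  have hyx : -y + x = -(y + -x) := by abel
  -- The inverse factors with the same middle conjugator `μ_x`, so the values of `μ_x⁻¹` at `y` and
  -- of `μ_x` at `-y` are negatives of each other; oddness finishes.
  have e' : (M.mu x.pt)⁻¹ =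
      M.α (-x).pt * (M.mu x.pt * M.α (-x).pt * (M.mu x.pt)⁻¹) * M.α (-x).pt := by
    rw [pt_neg, α_neg x.not_rel_inf]
    conv_lhs => rw [e]
    group
  obtain ⟨h1, h2⟩ := swapApp_of_eq hm.inv hm e' hy hxy
  obtain ⟨-, h3⟩ := swapApp_of_eq hm hm e (neg_notMem hy) (by rw [hyx]; exact neg_notMem hxy)
  have h4 : -swapApp (M.mu x.pt)⁻¹ (y + -x) + x = -(swapApp (M.mu x.pt)⁻¹ (y + -x) + -x) := by
    abel
  rw [hyx, swapApp_neg hm.inv hxy, h4, swapApp_neg hm h1, swapApp_neg hm hy] at h3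
  rw [h2, ← neg_inj, h3]
  abel

/-- The μ-maps are involutions on units. -/
theorem swapApp_mu_inv (hx : x ∉ M.nonunits) (hy : y ∉ M.nonunits) :
    swapApp (M.mu x.pt)⁻¹ y = swapApp (M.mu x.pt) y := by
  have hm := isSwap_mu_pt hx
  by_cases h : y - x ∈ M.nonunits
  -- The elements `y - x` and `-y - x` add up to `-2x`, a unit, so `-y` can replace `y`.
  · have h' : -y - x ∉ M.nonunits := fun h' => by
      have := add_mem h h'
      have e : y - x + (-y - x) = -(x + x) := by abel
      rw [e, neg_mem_iff, double_mem_iff] at this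
      exact hx this
    have := swapApp_mu_inv_of_sub hx (neg_notMem hy) h'
    rw [swapApp_neg hm hy, swapApp_neg hm.inv hy] at this
    exact neg_injective this
  · exact swapApp_mu_inv_of_sub hx hy h

/-! ## The torus -/

/-- The additive endomorphism of `X ∖ ∞̄` induced by an element of the torus. -/
def torusEnd (h : M.torus) : AddMonoid.End M.Carrier where
  toFun x := .mk (h.1 • x.pt) (fun hx => x.not_rel_inf ((torus_rel_inf h.2).1 hx))
  map_zero' := Carrier.ext h.2.2.1
  map_add' x y := by
    apply Carrier.ext
    show h.1 • (x + y).pt = M.add (h.1 • x.pt) (h.1 • y.pt)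
    have h1 : ∀ z : M.Carrier, ¬ M.rel (h.1 • z.pt) M.inf := fun z hz =>
      z.not_rel_inf ((torus_rel_inf h.2).1 hz)
    rw [add_eq (h1 x), ← torus_conj_α h.2 y.not_rel_inf, ← α_smul_pt, mul_smul, mul_smul,
      inv_smul_smul]

theorem pt_torusEnd (h : M.torus) (x : M.Carrier) : (torusEnd h x).pt = h.1 • x.pt := rfl

theorem torusEnd_mul (h k : M.torus) : torusEnd (h * k) = torusEnd h * torusEnd k := by
  ext x
  exact Carrier.ext (mul_smul _ _ _)

theorem torusEnd_mem_nonunits (h : M.torus) : torusEnd h x ∈ M.nonunits ↔ x ∈ M.nonunits := by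
  rw [mem_nonunits, pt_torusEnd, mem_nonunits]
  conv_lhs => rw [← h.2.2.1]
  exact M.rel_smul_iff h.1

theorem exists_unit_add_unit {e : M.Carrier} (he : e ∉ M.nonunits) (x : M.Carrier) :
    ∃ a b, a ∉ M.nonunits ∧ b ∉ M.nonunits ∧ x = a + b := by
  by_cases hx : x ∈ M.nonunits
  · exact ⟨e + x, -e, add_notMem_nonunits he hx, neg_notMem he, by abel⟩
  · by_cases hxe : x - e ∈ M.nonunits
    · refine ⟨x + e, -e, fun h => he ?_, neg_notMem he, by abel⟩
      have := sub_mem h hxe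
      rwa [add_sub_sub_cancel, double_mem_iff] at this
    · exact ⟨x - e, e, hxe, he, by abel⟩

/-- The square fixes units. It lies in the torus, hence acts additively, and every element is a sum
of two units. Points equivalent to `∞` are images under `μ_x` of points already treated. -/
theorem mu_mul_self (hx : x ∉ M.nonunits) : M.mu x.pt * M.mu x.pt = 1 := by
  have hm := isSwap_mu_pt hx
  have hunit : ∀ y ∉ M.nonunits, (M.mu x.pt * M.mu x.pt) • y.pt = y.pt := fun y hy => by
    rw [mul_smul, ← pt_swapApp hm hy, ← swapApp_mu_inv hx hy, ← pt_swapApp hm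
      (swapApp_notMem hm.inv hy), swapApp_swapApp_inv hm hy]
  have hall : ∀ y : M.Carrier, (M.mu x.pt * M.mu x.pt) • y.pt = y.pt := fun y => by
    obtain ⟨a, b, ha, hb, rfl⟩ := exists_unit_add_unit hx y
    let h : M.torus := ⟨_, hm.mul_mem_torus hm⟩
    have key : ∀ c ∉ M.nonunits, torusEnd h c = c := fun c hc => Carrier.ext (hunit c hc)
    have := congrArg Carrier.pt (map_add (torusEnd h) a b)
    rw [key a ha, key b hb] at this
    exact this
  apply Subtype.ext
  apply Equiv.ext
  intro p
  show (M.mu x.pt * M.mu x.pt) • p = p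
  by_cases hp : M.rel p M.inf
  · have h1 : ¬ M.rel ((M.mu x.pt)⁻¹ • p) M.inf := fun h =>
      M.inf_not_rel_zero (M.rel.trans (M.rel.symm hp) (hm.inv.rel_inf_iff.1 h))
    have h2 := hall (.mk _ h1)
    have h3 : p = M.mu x.pt • (M.mu x.pt)⁻¹ • p := (smul_inv_smul _ _).symm
    conv_lhs => rw [h3, mul_smul, ← mul_smul (M.mu x.pt)]
    exact (congrArg _ h2).trans h3.symm
  · exact hall (.mk p hp)

theorem mu_inv (hx : x ∉ M.nonunits) : (M.mu x.pt)⁻¹ = M.mu x.pt :=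
  inv_eq_of_mul_eq_one_left (mu_mul_self hx)

theorem mu_neg' (hx : x ∉ M.nonunits) : M.mu (-x).pt = M.mu x.pt := by rw [mu_neg hx, mu_inv hx]

/-! ## Divisibility by two -/

/-- Let `z` and `w` be the images of `x` and `2x`; conjugating `α_x` by `g` shows that `β_z` maps
`z` to `w`. Following `-z` through `μ_z = β_{-z} α_z β_{-z}`, with final value `z`, gives `z - w =
w`. -/
theorem swapApp_double (hg : M.IsSwap g) (hx : x ∉ M.nonunits) :
    swapApp g (x + x) + swapApp g (x + x) = swapApp g x := by
  set z := swapApp g x with hz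
  have hzu : z ∉ M.nonunits := swapApp_notMem hg hx
  have hxx : x + x ∉ M.nonunits := fun h => hx (double_mem_iff.1 h)
  have hβ : ∀ y : M.Carrier, y ∉ M.nonunits →
      M.β (swapApp g y).pt • (swapApp g y).pt = g • (y + y).pt := fun y hy => by
    rw [pt_swapApp hg hy, ← hg.conj_α y.not_rel_inf, mul_smul, mul_smul, inv_smul_smul, α_smul_pt]
  have h1 := mu_smul_neg_self hzu
  have h2 := hβ (-x) (neg_notMem hx)
  have h3 := hβ x hx
  have hneg : -x + -x = -(x + x) := by abel
  rw [swapApp_neg hg hx, hneg, ← pt_swapApp hg (neg_notMem hxx), swapApp_neg hg hxx, ← hz] at h2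
  rw [← hz, ← pt_swapApp hg hxx] at h3
  rw [mu_eq_β_α_β hzu, mul_smul, mul_smul, h2, α_smul_pt, ← inv_β_pt hzu, inv_smul_eq_iff,
    h3] at h1
  have h4 := Carrier.ext h1
  rw [neg_add_eq_sub, sub_eq_iff_eq_add] at h4
  exact h4.symm

theorem double_injective {e : M.Carrier} (he : e ∉ M.nonunits) (h : x + x = y + y) : x = y := by
  have hm := isSwap_mu_pt he
  -- If `2z = 0`, then `e + z` and `e` have the same double, so by `swapApp_double` the same image
  -- under an injective map.
  have main : ∀ z : M.Carrier, z + z = 0 → z = 0 := fun z hz => by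
    have hz' : z ∈ M.nonunits := double_mem_iff.1 (hz ▸ zero_mem _)
    have hez := add_notMem_nonunits he hz'
    have h1 := swapApp_double hm hez
    have h2 : e + z + (e + z) = e + e := by rw [add_add_add_comm, hz, add_zero]
    rw [h2, swapApp_double hm he] at h1
    have h3 := congrArg (swapApp (M.mu e.pt)⁻¹) h1
    rw [swapApp_inv_swapApp hm he, swapApp_inv_swapApp hm hez] at h3
    simpa using h3
  rw [← sub_eq_zero]
  apply main
  rw [sub_add_sub_comm, h, sub_self]

theorem exists_half {e : M.Carrier} (he : e ∉ M.nonunits) (x : M.Carrier) : ∃ y, y + y = x := by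
  have hm := isSwap_mu_pt he
  have main : ∀ z ∉ M.nonunits, ∃ y, y + y = z := fun z hz => by
    have := swapApp_double hm (swapApp_notMem hm.inv hz)
    rw [swapApp_swapApp_inv hm hz] at this
    exact ⟨_, this⟩
  obtain ⟨a, b, ha, hb, rfl⟩ := exists_unit_add_unit he x
  obtain ⟨c, rfl⟩ := main a ha
  obtain ⟨d, rfl⟩ := main b hb
  exact ⟨c + d, add_add_add_comm _ _ _ _⟩

theorem half_pt {e : M.Carrier} (he : e ∉ M.nonunits) (x : M.Carrier) :
    M.half (x + x).pt = x.pt := by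
  have h : ∃ y, ¬ M.rel y M.inf ∧ M.add y y = (x + x).pt := ⟨x.pt, x.not_rel_inf, rfl⟩
  rw [half, dif_pos h]
  have h2 : (Carrier.mk _ h.choose_spec.1 : M.Carrier) + .mk _ h.choose_spec.1 = x + x :=
    Carrier.ext h.choose_spec.2
  exact congrArg Carrier.pt (double_injective he h2)

/-! ## The sum formula for μ-maps -/

theorem swapApp_mu_sub_swapApp_mu (hx : x ∉ M.nonunits) (hy : y ∉ M.nonunits)
    (hxy : x + y ∉ M.nonunits) :
    swapApp (M.mu y.pt) (x + y) - swapApp (M.mu x.pt) (x + y) = x - y := by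
  have hβ : ∀ z : M.Carrier, z ∉ M.nonunits →
      M.β (-z).pt = (M.α z.pt)⁻¹ * M.mu z.pt * (M.α z.pt)⁻¹ := fun z hz => by
    rw [mu_eq_α_β_α hz]; group
  -- `U_0` is abelian, being conjugate to `U_∞` under a μ-map.
  have hcomm : M.β (-x).pt * M.β (-y).pt = M.β (-y).pt * M.β (-x).pt := by
    have hm := isSwap_mu_pt hx
    have := IsSpecialAbelian.comm _ (α_mem (Carrier.not_rel_inf (swapApp (M.mu x.pt)⁻¹ (-x)))) _
      (α_mem (Carrier.not_rel_inf (swapApp (M.mu x.pt)⁻¹ (-y))))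
    have h1 : ∀ z ∉ M.nonunits, M.β z.pt =
        M.mu x.pt * M.α (swapApp (M.mu x.pt)⁻¹ z).pt * (M.mu x.pt)⁻¹ := fun z hz => by
      rw [hm.conj_α (Carrier.not_rel_inf _),
        ← pt_swapApp hm (swapApp_notMem hm.inv hz), swapApp_swapApp_inv hm hz]
    rw [h1 _ (neg_notMem hx), h1 _ (neg_notMem hy)]
    calc _ = M.mu x.pt * (M.α (swapApp (M.mu x.pt)⁻¹ (-x)).pt *
          M.α (swapApp (M.mu x.pt)⁻¹ (-y)).pt) * (M.mu x.pt)⁻¹ := by group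
      _ = _ := by rw [this]; group
  -- The value at `∞` is computed by starting from `-w` and expanding `β_{-z}` as `α_{-z} μ_z
  -- α_{-z}`.
  have hval : ∀ z w : M.Carrier, z ∉ M.nonunits → w ∉ M.nonunits → z + w ∉ M.nonunits →
      (M.β (-z).pt * M.β (-w).pt) • M.inf = (-swapApp (M.mu z.pt) (z + w) - z).pt :=
    fun z w hz hw hzw => by
      have e : -w - z = -(z + w) := by abel
      rw [mul_smul, β_smul_inf (neg_notMem hw), hβ z hz, mul_smul, mul_smul, α_inv_smul_pt, e,
        ← pt_swapApp (isSwap_mu_pt hz) (neg_notMem hzw), swapApp_neg (isSwap_mu_pt hz) hzw,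
        α_inv_smul_pt]
  have h : (M.β (-x).pt * M.β (-y).pt) • M.inf = (M.β (-y).pt * M.β (-x).pt) • M.inf := by
    rw [hcomm]
  rw [hval x y hx hy hxy, hval y x hy hx (by rwa [add_comm]), add_comm y x] at h
  have h4 := Carrier.ext h
  rw [← sub_eq_zero] at h4 ⊢
  rw [← h4]
  abel

end PointedLocalMoufangSet
end LMS

namespace LMS

namespace PointedLocalMoufangSet

universe u

variable {X : Type u} {M : PointedLocalMoufangSet X} [IsSpecialAbelian M] {e x y u v : M.Carrier}

/-! ## Hua maps and the ring structure -/

theorem mu_mul_mu_mem_huaSubgroup (he : e ∉ M.nonunits) (hu : u ∉ M.nonunits) :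
    M.mu u.pt * M.mu e.pt ∈ M.huaSubgroup :=
  Subgroup.subset_closure ⟨_, _, isUnitPoint_iff.2 he, isUnitPoint_iff.2 hu, rfl⟩

/-- The endomorphism of `X ∖ ∞̄` induced by an element of the Hua subgroup. -/
def huaSubgroupEnd (h : M.huaSubgroup) : AddMonoid.End M.Carrier :=
  torusEnd ⟨h.1, huaSubgroup_le_torus h.2⟩

/-- The Hua map `h_u = μ_e μ_u` as an endomorphism of `X ∖ ∞̄`. -/
def huaEnd (he : e ∉ M.nonunits) (hu : u ∉ M.nonunits) : AddMonoid.End M.Carrier :=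
  huaSubgroupEnd ⟨_, mu_mul_mu_mem_huaSubgroup he hu⟩

theorem pt_huaEnd (he : e ∉ M.nonunits) (hu : u ∉ M.nonunits) (x : M.Carrier) :
    (huaEnd he hu x).pt = M.hua e.pt u.pt x.pt :=
  mul_smul _ _ _

theorem huaEnd_apply (he : e ∉ M.nonunits) (hu : u ∉ M.nonunits) (hx : x ∉ M.nonunits) :
    huaEnd he hu x = swapApp (M.mu u.pt) (swapApp (M.mu e.pt) x) := by
  apply Carrier.ext
  rw [pt_huaEnd, pt_swapApp (isSwap_mu_pt hu) (swapApp_notMem (isSwap_mu_pt he) hx),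
    pt_swapApp (isSwap_mu_pt he) hx]
  rfl

theorem huaEnd_apply_self (he : e ∉ M.nonunits) (hu : u ∉ M.nonunits) :
    huaEnd he hu e = -swapApp (M.mu u.pt) e := by
  rw [huaEnd_apply he hu he, swapApp_mu_self he, swapApp_neg (isSwap_mu_pt hu) he]

theorem huaEnd_self (he : e ∉ M.nonunits) : huaEnd he he = 1 := by
  ext x
  apply Carrier.ext
  show (M.mu e.pt * M.mu e.pt) • x.pt = x.pt
  rw [mu_mul_self he, one_smul]

theorem huaEnd_neg (he : e ∉ M.nonunits) (hu : u ∉ M.nonunits) :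
    huaEnd he (neg_notMem hu) = huaEnd he hu := by
  ext x
  apply Carrier.ext
  rw [pt_huaEnd, pt_huaEnd, hua, hua, mu_neg' hu]

/-- The polarization of `u ↦ e h_u` at `e`. -/
theorem huaEnd_sub_huaEnd (he : e ∉ M.nonunits) (hu : u ∉ M.nonunits) (hv : v ∉ M.nonunits)
    (h : u = v + e) : huaEnd he hu e - huaEnd he hv e = u + v := by
  have huv : u + -v = e := by rw [h]; abel
  have := swapApp_mu_sub_swapApp_mu hu (neg_notMem hv) (by rwa [huv])
  rw [huv, mu_neg' hv, sub_neg_eq_add] at this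
  rw [huaEnd_apply_self, huaEnd_apply_self, ← this]
  abel

variable (M) in
/-- The ring of endomorphisms of `X ∖ ∞̄` generated by the Hua subgroup. -/
def huaRing : Subring (AddMonoid.End M.Carrier) := Subring.closure (Set.range huaSubgroupEnd)

theorem huaEnd_mem_huaRing (he : e ∉ M.nonunits) (hu : u ∉ M.nonunits) :
    huaEnd he hu ∈ M.huaRing :=
  Subring.subset_closure ⟨_, rfl⟩

/-- The generators commute because the Hua subgroup does, and this passes to the subring they
generate. -/
theorem huaRing_comm (hH : ∀ g ∈ M.huaSubgroup, ∀ h ∈ M.huaSubgroup, g * h = h * g)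
    {F F' : AddMonoid.End M.Carrier} (hF : F ∈ M.huaRing) (hF' : F' ∈ M.huaRing) :
    F * F' = F' * F := by
  have := Subring.isMulCommutative_closure (s := Set.range (huaSubgroupEnd (M := M))) (by
    rintro _ ⟨g, rfl⟩ _ ⟨h, rfl⟩
    rw [huaSubgroupEnd, huaSubgroupEnd, ← torusEnd_mul, ← torusEnd_mul]
    congr 1
    exact Subtype.ext (hH _ g.2 _ h.2))
  exact congrArg Subtype.val (this.is_comm.comm ⟨F, hF⟩ ⟨F', hF'⟩)

theorem huaRing_apply_mem {F : AddMonoid.End M.Carrier} (hF : F ∈ M.huaRing)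
    (hx : x ∈ M.nonunits) : F x ∈ M.nonunits := by
  induction hF using Subring.closure_induction generalizing x with
  | mem F hF =>
    obtain ⟨h, rfl⟩ := hF
    exact (torusEnd_mem_nonunits _).2 hx
  | zero => exact zero_mem _
  | one => exact hx
  | add F F' _ _ h1 h2 => exact add_mem (h1 hx) (h2 hx)
  | neg F _ h1 => exact neg_mem (h1 hx)
  | mul F F' _ _ h1 h2 => exact h1 (h2 hx)

/-- In each case the differences of Hua maps telescope at `e` by `huaEnd_sub_huaEnd`, and every
index occurring is a unit because `2e` is. -/
theorem exists_Rmap_eq (he : e ∉ M.nonunits) (y : M.Carrier) :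
    ∃ F ∈ M.huaRing, (∀ x, (F x).pt = M.Rmap e.pt y.pt x.pt) ∧ F e = y + y := by
  by_cases hy : y ∈ M.nonunits
  · have h2e : e + e ∉ M.nonunits := fun h => he (double_mem_iff.1 h)
    have h1 := add_notMem_nonunits h2e hy
    have h2 := add_notMem_nonunits he hy
    have h3 := neg_notMem h2e
    refine ⟨huaEnd he h1 - huaEnd he h2 - huaEnd he h3 + 1,
      add_mem (sub_mem (sub_mem (huaEnd_mem_huaRing _ _) (huaEnd_mem_huaRing _ _))
        (huaEnd_mem_huaRing _ _)) (one_mem _), fun x => ?_, ?_⟩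
    · rw [Rmap, if_neg (fun h => (isUnitPoint_iff.1 h) hy), sub_eq_add_neg, sub_eq_add_neg]
      simp only [← pt_add, ← pt_neg, ← pt_huaEnd he h1, ← pt_huaEnd he h2, ← pt_huaEnd he h3]
      rfl
    · have e1 := huaEnd_sub_huaEnd he h1 h2 (by abel)
      -- Since `h_e = 1`, this gives `e h_{2e} = 4e`; the total is `(3e + 2y) - 4e + e = 2y`.
      have e2 := huaEnd_sub_huaEnd he h2e he rfl
      rw [huaEnd_self, AddMonoid.End.coe_one, id, sub_eq_iff_eq_add] at e2
      show huaEnd he h1 e - huaEnd he h2 e - huaEnd he h3 e + e = y + y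
      rw [huaEnd_neg he h2e, e1, e2]
      abel
  · by_cases hye : y + e ∈ M.nonunits
    · have h1 : -e + y ∉ M.nonunits := fun h => he <| by
        have := sub_mem hye h
        have e1 : y + e - (-e + y) = e + e := by abel
        rwa [e1, double_mem_iff] at this
      refine ⟨-huaEnd he h1 + 1 + huaEnd he hy, add_mem (add_mem (neg_mem (huaEnd_mem_huaRing _ _))
        (one_mem _)) (huaEnd_mem_huaRing _ _), fun x => ?_, ?_⟩
      · rw [Rmap, if_pos (isUnitPoint_iff.2 hy), ← pt_add,
          if_neg (fun h => (isUnitPoint_iff.1 h) hye)]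
        simp only [← pt_add, ← pt_neg, ← pt_huaEnd he h1, ← pt_huaEnd he hy]
        rfl
      · have e1 := huaEnd_sub_huaEnd he hy h1 (by abel)
        rw [sub_eq_iff_eq_add] at e1
        show -huaEnd he h1 e + e + huaEnd he hy e = y + y
        rw [e1]
        abel
    · have h1 : e + y ∉ M.nonunits := by rwa [add_comm]
      refine ⟨huaEnd he h1 - huaEnd he hy - 1, sub_mem (sub_mem (huaEnd_mem_huaRing _ _)
        (huaEnd_mem_huaRing _ _)) (one_mem _), fun x => ?_, ?_⟩
      · rw [Rmap, if_pos (isUnitPoint_iff.2 hy), ← pt_add y,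
          if_pos (isUnitPoint_iff.2 hye), sub_eq_add_neg,
          sub_eq_add_neg]
        simp only [← pt_add, ← pt_neg, ← pt_huaEnd he h1, ← pt_huaEnd he hy]
        rfl
      · have e1 := huaEnd_sub_huaEnd he h1 hy (by abel)
        show huaEnd he h1 e - huaEnd he hy e - e = y + y
        rw [e1]
        abel

/-- The endomorphism `R_y` of `X ∖ ∞̄`. -/
def REnd (he : e ∉ M.nonunits) (y : M.Carrier) : AddMonoid.End M.Carrier :=
  (exists_Rmap_eq he y).choose

theorem REnd_mem_huaRing (he : e ∉ M.nonunits) (y : M.Carrier) : REnd he y ∈ M.huaRing :=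
  (exists_Rmap_eq he y).choose_spec.1

theorem pt_REnd (he : e ∉ M.nonunits) (y x : M.Carrier) :
    (REnd he y x).pt = M.Rmap e.pt y.pt x.pt :=
  (exists_Rmap_eq he y).choose_spec.2.1 x

theorem REnd_apply_self (he : e ∉ M.nonunits) (y : M.Carrier) : REnd he y e = y + y :=
  (exists_Rmap_eq he y).choose_spec.2.2

variable (M) in
/-- A unit point, together with the commutativity of the Hua subgroup. -/
class AbelianHua where
  unit : M.Carrier
  unit_notMem : unit ∉ M.nonunits
  hua_comm : ∀ g ∈ M.huaSubgroup, ∀ h ∈ M.huaSubgroup, g * h = h * g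

/-! ### The commutative ring structure -/

variable [AbelianHua M]

open AbelianHua

scoped instance : One M.Carrier := ⟨unit⟩

scoped instance : Mul M.Carrier := ⟨fun x y => M.toCarrier (M.mul (1 : M.Carrier).pt x.pt y.pt)⟩

theorem one_notMem : (1 : M.Carrier) ∉ M.nonunits := unit_notMem

theorem pt_mul (x y : M.Carrier) : (x * y).pt = M.mul (1 : M.Carrier).pt x.pt y.pt := by
  apply pt_toCarrier
  obtain ⟨z, hz⟩ := exists_half one_notMem (REnd one_notMem y x)
  rw [mul, ← pt_REnd one_notMem, ← hz, half_pt one_notMem]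
  exact z.not_rel_inf

theorem mul_add_mul (x y : M.Carrier) : x * y + x * y = REnd one_notMem y x := by
  obtain ⟨z, hz⟩ := exists_half one_notMem (REnd one_notMem y x)
  have : x * y = z := Carrier.ext (by
    rw [pt_mul, mul, ← pt_REnd one_notMem, ← hz, half_pt one_notMem])
  rw [this, hz]

theorem double_inj (h : x + x = y + y) : x = y := double_injective one_notMem h

theorem endo_mul {F : AddMonoid.End M.Carrier} (hF : F ∈ M.huaRing) (x y : M.Carrier) :
    F (x * y) = F x * y := by
  apply double_inj
  rw [mul_add_mul, ← map_add, mul_add_mul]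
  exact DFunLike.congr_fun (huaRing_comm hua_comm hF (REnd_mem_huaRing one_notMem y)) x

/-- With `1 R_x = 2x`, both `4xy` and `4yx` become values at `1` of products of the commuting
operators `R_x` and `R_y`. -/
theorem carrier_mul_comm (x y : M.Carrier) : x * y = y * x := by
  apply double_inj
  apply double_inj
  rw [mul_add_mul, mul_add_mul, ← map_add, ← map_add, ← REnd_apply_self one_notMem x,
    ← REnd_apply_self one_notMem y]
  exact DFunLike.congr_fun (huaRing_comm hua_comm (REnd_mem_huaRing one_notMem y)
    (REnd_mem_huaRing one_notMem x)) 1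

theorem carrier_add_mul (x y z : M.Carrier) : (x + y) * z = x * z + y * z := by
  apply double_inj
  rw [mul_add_mul, map_add, ← mul_add_mul, ← mul_add_mul]
  abel

theorem carrier_one_mul (x : M.Carrier) : 1 * x = x := by
  apply double_inj
  rw [mul_add_mul, REnd_apply_self]

theorem carrier_mul_assoc (x y z : M.Carrier) : x * y * z = x * (y * z) := by
  rw [carrier_mul_comm y z, carrier_mul_comm x (z * y), carrier_mul_comm x y]
  -- `R_z` is itself in the Hua ring, so up to a factor `2` this reads `(yx)z = (yz)x`.
  have h := endo_mul (REnd_mem_huaRing one_notMem z) y x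
  rw [← mul_add_mul, ← mul_add_mul, carrier_add_mul] at h
  rw [double_inj h, carrier_mul_comm z y]

scoped instance : CommRing M.Carrier where
  left_distrib x y z := by
    rw [carrier_mul_comm, carrier_add_mul, carrier_mul_comm y, carrier_mul_comm z]
  right_distrib := carrier_add_mul
  zero_mul x := by
    have := carrier_add_mul 0 0 x
    rwa [add_zero, left_eq_add] at this
  mul_zero x := by
    have := carrier_add_mul 0 0 x
    rwa [add_zero, left_eq_add, carrier_mul_comm] at this
  mul_assoc := carrier_mul_assoc
  one_mul := carrier_one_mul
  mul_one x := by rw [carrier_mul_comm, carrier_one_mul]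
  mul_comm := carrier_mul_comm
  neg_add_cancel := neg_add_cancel
  zsmul := zsmulRec

/-! ### Invertible elements and locality -/

theorem endo_apply {F : AddMonoid.End M.Carrier} (hF : F ∈ M.huaRing) (x : M.Carrier) :
    F x = F 1 * x := by
  rw [← endo_mul hF, one_mul]

/-- Torus elements fix `0` and so preserve its class, which is a subgroup; hence `R_y` preserves it
too. -/
theorem mul_mem_nonunits (hx : x ∈ M.nonunits) (y : M.Carrier) : x * y ∈ M.nonunits := by
  rw [← double_mem_iff, mul_add_mul]
  exact huaRing_apply_mem (REnd_mem_huaRing _ y) hx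

theorem notMem_of_isUnit (h : IsUnit x) : x ∉ M.nonunits := fun hx => by
  obtain ⟨y, hy⟩ := h.exists_right_inv
  exact one_notMem (hy ▸ mul_mem_nonunits hx y)

/-- `x h_u = (e h_u) x`. -/
theorem huaEnd_eq_mul (hu : u ∉ M.nonunits) (x : M.Carrier) :
    huaEnd one_notMem hu x = huaEnd one_notMem hu 1 * x :=
  endo_apply (huaEnd_mem_huaRing _ _) x

/-- The μ-map `μ_1` is `u ↦ -u⁻¹` on units. -/
theorem swapApp_mu_one_mul (hu : u ∉ M.nonunits) :
    swapApp (M.mu (1 : M.Carrier).pt) u * u = -1 := by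
  have h1 := one_notMem (M := M)
  have hm1 := isSwap_mu_pt h1
  have key : ∀ a : M.Carrier, a ∉ M.nonunits → a + 1 ∉ M.nonunits →
      swapApp (M.mu (1 : M.Carrier).pt) a * a = -1 := fun a ha ha1 => by
    have e1 := huaEnd_sub_huaEnd h1 ha1 ha rfl
    have e2 := swapApp_mu_sub_swapApp_mu ha1 (neg_notMem h1) (by rwa [add_neg_cancel_right])
    rw [add_neg_cancel_right, mu_neg' h1] at e2
    set b := swapApp (M.mu (1 : M.Carrier).pt) a with hb
    have hbu : b ∉ M.nonunits := swapApp_notMem hm1 ha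
    have hba : swapApp (M.mu (1 : M.Carrier).pt) b = a := by
      rw [hb, ← swapApp_mu_inv h1 (swapApp_notMem hm1 ha), swapApp_inv_swapApp hm1 ha]
    have e3 : huaEnd h1 ha b = -a := by
      rw [huaEnd_apply h1 ha hbu, hba, swapApp_mu_self ha]
    have e4 : swapApp (M.mu (a + 1).pt) a = huaEnd h1 ha1 b := by
      rw [huaEnd_apply h1 ha1 hbu, hba]
    rw [e4, huaEnd_eq_mul, ← sub_add_cancel (huaEnd h1 ha1 1) (huaEnd h1 ha 1), e1] at e2
    rw [huaEnd_eq_mul] at e3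
    apply double_inj
    linear_combination -e2 - e3
  by_cases h : u + 1 ∈ M.nonunits
  · have h' : -u + 1 ∉ M.nonunits := fun h' => h1 <| by
      have := add_mem h h'
      have e : u + 1 + (-u + 1) = 1 + 1 := by ring
      rwa [e, double_mem_iff] at this
    have := key (-u) (neg_notMem hu) h'
    rwa [swapApp_neg hm1 hu, neg_mul_neg] at this
  · exact key u hu h

theorem isUnit_iff : IsUnit u ↔ u ∉ M.nonunits := by
  refine ⟨notMem_of_isUnit, fun h => IsUnit.of_mul_eq_one (-swapApp (M.mu (1 : M.Carrier).pt) u) ?_⟩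
  rw [mul_neg, mul_comm, swapApp_mu_one_mul h, neg_neg]

scoped instance : Nontrivial M.Carrier :=
  ⟨⟨1, 0, fun h => one_notMem (M := M) (h ▸ zero_mem _)⟩⟩

scoped instance : IsLocalRing M.Carrier := IsLocalRing.of_nonunits_add fun a b ha hb => by
  rw [mem_nonunits_iff, isUnit_iff, not_not] at *
  exact add_mem ha hb

theorem mem_maximalIdeal_iff : u ∈ IsLocalRing.maximalIdeal M.Carrier ↔ u ∈ M.nonunits := by
  rw [IsLocalRing.mem_maximalIdeal, mem_nonunits_iff, isUnit_iff, not_not]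

end PointedLocalMoufangSet
end LMS

namespace LMS

universe u v

/-! ## Points of the projective line -/

section ProjectiveLine

variable {R : Type u} [CommRing R]

/-- Turns equality of points into a polynomial identity. Bézout coefficients of `v` produce the
scalar, and those of `w` its inverse. -/
theorem lineSetoid_iff (v w : UnimodularPair R) : lineSetoid R v w ↔ pairDet v w = 0 := by
  constructor
  · rintro ⟨c, hc⟩
    simp only [pairDet, hc, Pi.smul_apply, smul_eq_mul]
    ring
  · intro h
    obtain ⟨a, b, hv⟩ := v.2
    obtain ⟨a', b', hw⟩ := w.2
    rw [pairDet] at h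
    have h0 : w.1 0 = (a * w.1 0 + b * w.1 1) * v.1 0 := by
      linear_combination (-w.1 0) * hv - b * h
    have h1 : w.1 1 = (a * w.1 0 + b * w.1 1) * v.1 1 := by
      linear_combination (-w.1 1) * hv + a * h
    have hu : (a * w.1 0 + b * w.1 1) * (a' * v.1 0 + b' * v.1 1) = 1 := by
      linear_combination hw - a' * h0 - b' * h1
    refine ⟨Units.mkOfMulEqOne _ _ hu, ?_⟩
    funext i
    fin_cases i
    · exact h0
    · exact h1

theorem ProjLine.mk_eq_mk_iff {a b c d : R} (h : IsCoprime a b) (h' : IsCoprime c d) :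
    ProjLine.mk a b h = ProjLine.mk c d h' ↔ a * d - b * c = 0 :=
  Quotient.eq.trans (lineSetoid_iff _ _)

theorem ProjLine.mk_eq_lineMul_upper_iff {a b c d r : R} (h : IsCoprime a b) (h' : IsCoprime c d) :
    ProjLine.mk c d h' = lineMul (upperUnipotent r) (ProjLine.mk a b h) ↔
      c * (a * r + b) - d * a = 0 := by
  refine Quotient.eq.trans ((lineSetoid_iff _ _).trans ?_)
  simp [pairDet, rowMul, upperUnipotent]

theorem ProjLine.mk_eq_lineMul_weyl_iff {a b c d : R} (h : IsCoprime a b) (h' : IsCoprime c d) :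
    ProjLine.mk c d h' = lineMul (weylMatrix R) (ProjLine.mk a b h) ↔ c * a + d * b = 0 := by
  refine Quotient.eq.trans ((lineSetoid_iff _ _).trans ?_)
  simp [pairDet, rowMul, weylMatrix]

end ProjectiveLine

/-! ## Transport along a bijection -/

section Transport

variable {X : Type u} {Y : Type v} {r : Setoid X} {s : Setoid Y} (φ : X ≃ Y)
  (hφ : ∀ x y, r x y ↔ s (φ x) (φ y))

/-- The isomorphism `Sym(X, ∼) ≃ Sym(Y, ∼)` induced by a bijection. -/
def symRelCongr : SymRel r ≃* SymRel s where
  toFun g := ⟨φ.permCongr g.1, fun x y => by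
    have h := hφ (φ.symm x) (φ.symm y)
    rw [φ.apply_symm_apply, φ.apply_symm_apply] at h
    exact h.symm.trans ((g.2 _ _).trans (hφ _ _))⟩
  invFun g := ⟨φ.symm.permCongr g.1, fun x y => by
    refine (hφ x y).trans ((g.2 _ _).trans ?_)
    have h := hφ (φ.symm (g.1 (φ x))) (φ.symm (g.1 (φ y)))
    rw [φ.apply_symm_apply, φ.apply_symm_apply] at h
    exact h.symm⟩
  left_inv g := by
    apply Subtype.ext
    ext x
    simp
  right_inv g := by
    apply Subtype.ext
    ext x
    simp
  map_mul' g h := by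
    apply Subtype.ext
    ext x
    simp

theorem symRelCongr_smul (g : SymRel r) (x : X) : symRelCongr φ hφ g • φ x = φ (g • x) :=
  congrArg (fun z => φ (g.1 z)) (φ.symm_apply_apply x)

theorem symRelCongr_eq (g : SymRel r) (h : SymRel s) (H : ∀ x, φ (g • x) = h • φ x) :
    symRelCongr φ hφ g = h := by
  apply Subtype.ext
  apply Equiv.ext
  intro y
  obtain ⟨x, rfl⟩ := φ.surjective y
  exact (symRelCongr_smul φ hφ g x).trans (H x)

theorem map_conjSubgroup {G : Type u} {G' : Type v} [Group G] [Group G'] (f : G →* G')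
    (H : Subgroup G) (g : G) :
    (conjSubgroup H g).map f = conjSubgroup (H.map f) (f g) := by
  rw [conjSubgroup, conjSubgroup, Subgroup.map_map, Subgroup.map_map]
  congr 1
  ext h
  simp

/-- A bijection that transports the root groups induces an isomorphism. -/
theorem Iso.nonempty_of_map_eq (M : RootGroupData X) (N : RootGroupData Y) (φ : X ≃ Y)
    (hφ : ∀ x y, M.rel x y ↔ N.rel (φ x) (φ y))
    (h : ∀ x, (M.U x).map (symRelCongr φ hφ).toMonoidHom = N.U (φ x)) : Nonempty (Iso M N) :=
  ⟨{ φ := φ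
     θ := fun x => ((symRelCongr φ hφ).subgroupMap (M.U x)).trans (MulEquiv.subgroupCongr (h x))
     rel_iff := hφ
     map_smul := fun x _ u => (symRelCongr_smul φ hφ u.1 x).symm }⟩

end Transport

namespace PointedLocalMoufangSet

variable {X : Type u} {M : PointedLocalMoufangSet X}

/-! ## Recovering the root groups from `U_∞` and a swap -/

theorem conjSubgroup_of_isSwap {g : SymRel M.rel} (hg : M.IsSwap g) :
    conjSubgroup (M.U M.inf) g = M.U M.zero := by
  rw [M.lm3 _ _ hg.mem, hg.smul_inf]

theorem U_eq_of_not_rel {g : SymRel M.rel} (hg : M.IsSwap g) {x : X} (hx : ¬ M.rel x M.inf) :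
    M.U x = conjSubgroup (conjSubgroup (M.U M.inf) g) (M.α x) := by
  rw [conjSubgroup_of_isSwap hg, M.lm3 _ _ (M.mem_littleProjectiveGroup (α_mem hx)),
    α_smul_zero hx]

theorem U_eq_of_rel {g : SymRel M.rel} (hg : M.IsSwap g) {x : X} (hx : M.rel x M.inf) :
    M.U x = conjSubgroup (M.U M.inf) (g * M.α (g⁻¹ • x) * g⁻¹) := by
  have h : ¬ M.rel (g⁻¹ • x) M.inf := fun h =>
    M.inf_not_rel_zero (M.rel.trans (M.rel.symm hx) (hg.inv.rel_inf_iff.1 h))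
  rw [M.lm3 _ _ (mul_mem (mul_mem hg.mem (M.mem_littleProjectiveGroup (α_mem h)))
      (inv_mem hg.mem)), mul_smul, mul_smul, hg.inv.smul_inf, α_smul_zero h, smul_inv_smul]

/-- The choice in `translation` is forced by sharp transitivity of `U_∞`, so it is compatible with
transport. -/
theorem translation_map {Y : Type v} {s : Setoid Y} (φ : X ≃ Y)
    (hφ : ∀ x y, M.rel x y ↔ s (φ x) (φ y)) {x : X} (hx : ¬ M.rel x M.inf) :
    translation ((M.U M.inf).map (symRelCongr φ hφ).toMonoidHom) (φ M.zero) (φ x) =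
      symRelCongr φ hφ (M.α x) := by
  have h : ∃ g, g ∈ (M.U M.inf).map (symRelCongr φ hφ).toMonoidHom ∧ g • φ M.zero = φ x :=
    ⟨_, ⟨_, α_mem hx, rfl⟩, by
      show symRelCongr φ hφ (M.α x) • φ M.zero = φ x
      rw [symRelCongr_smul, α_smul_zero hx]⟩
  rw [translation, dif_pos h]
  obtain ⟨⟨g, hg, hge⟩, h2⟩ := h.choose_spec
  rw [← hge] at h2 ⊢
  have h3 : φ (g • M.zero) = φ x := (symRelCongr_smul φ hφ g M.zero).symm.trans h2
  rw [← eq_α hg (φ.injective h3)]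
  rfl

/-- By (LM3), every root group is conjugate to `U_∞` by an explicit word in `g` and translations;
the bijection transports these words. -/
theorem map_U_eq {Y : Type v} {s : Setoid Y} (φ : X ≃ Y)
    (hφ : ∀ x y, M.rel x y ↔ s (φ x) (φ y)) {g : SymRel M.rel} (hg : M.IsSwap g) (x : X) :
    (M.U x).map (symRelCongr φ hφ).toMonoidHom =
      (ofRootGroup s ((M.U M.inf).map (symRelCongr φ hφ).toMonoidHom) (symRelCongr φ hφ g)
        (φ M.inf)).U (φ x) := by
  simp only [ofRootGroup, ← map_inv, symRelCongr_smul, hg.smul_inf]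
  split_ifs with hx <;> rw [← hφ] at hx
  · have h : ¬ M.rel (g⁻¹ • x) M.inf := fun h =>
      M.inf_not_rel_zero (M.rel.trans (M.rel.symm hx) (hg.inv.rel_inf_iff.1 h))
    rw [translation_map φ hφ h, U_eq_of_rel hg hx, map_conjSubgroup]
    simp
  · rw [translation_map φ hφ hx, U_eq_of_not_rel hg hx, map_conjSubgroup, map_conjSubgroup]
    rfl

/-! ## The bijection with the projective line -/

variable [IsSpecialAbelian M] [AbelianHua M]

variable (M) in
/-- The μ-map of the identity element. -/
def weyl : SymRel M.rel := M.mu (1 : M.Carrier).pt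

theorem isSwap_weyl : M.IsSwap M.weyl := isSwap_mu_pt one_notMem

theorem weyl_smul_weyl_smul (p : X) : M.weyl • M.weyl • p = p := by
  rw [← mul_smul, weyl, mu_mul_self one_notMem, one_smul]

theorem swapApp_weyl_mul {u : M.Carrier} (hu : u ∉ M.nonunits) : swapApp M.weyl u * u = -1 :=
  swapApp_mu_one_mul hu

theorem rel_weyl_smul {z : M.Carrier} (hz : z ∈ M.nonunits) : M.rel (M.weyl • z.pt) M.inf :=
  isSwap_weyl.rel_inf_iff.2 hz

theorem exists_eq_pt_or_weyl (p : X) :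
    (∃ r : M.Carrier, p = r.pt) ∨ ∃ z ∈ M.nonunits, p = M.weyl • z.pt := by
  by_cases hp : M.rel p M.inf
  · have h1 : ¬ M.rel (M.weyl • p) M.inf := fun h =>
      M.inf_not_rel_zero (M.rel.trans (M.rel.symm hp) (isSwap_weyl.rel_inf_iff.1 h))
    exact .inr ⟨.mk _ h1, isSwap_weyl.rel_zero_iff.2 hp, (weyl_smul_weyl_smul p).symm⟩
  · exact .inl ⟨.mk p hp, rfl⟩

open Classical in
variable (M) in
/-- The map `X → P¹(R)` with `r ↦ [1, r]` and `z μ_1 ↦ [-z, 1]` for `z ∼ 0`. -/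
def toProj (p : X) : ProjLine M.Carrier :=
  if M.rel p M.inf then .mk (-M.toCarrier (M.weyl • p)) 1 isCoprime_one_right
  else .mk 1 (M.toCarrier p) isCoprime_one_left

theorem toProj_pt (r : M.Carrier) : M.toProj r.pt = .mk 1 r isCoprime_one_left := by
  simp only [toProj, if_neg r.not_rel_inf, toCarrier_pt]

/-- The sign is that of the Weyl matrix, which sends the row `(1, z)` to `(-z, 1)`. -/
theorem toProj_weyl {z : M.Carrier} (hz : z ∈ M.nonunits) :
    M.toProj (M.weyl • z.pt) = .mk (-z) 1 isCoprime_one_right := by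
  simp only [toProj, if_pos (rel_weyl_smul hz), weyl_smul_weyl_smul, toCarrier_pt]

theorem one_sub_mul_notMem {z : M.Carrier} (hz : z ∈ M.nonunits) (y : M.Carrier) :
    1 - z * y ∉ M.nonunits := fun h => one_notMem <| by
  have := add_mem h (mul_mem_nonunits hz y)
  rwa [sub_add_cancel] at this

theorem rel_iff_toProj (p q : X) :
    M.rel p q ↔ projRel M.Carrier (M.toProj p) (M.toProj q) := by
  rcases exists_eq_pt_or_weyl (M := M) p with ⟨r, rfl⟩ | ⟨z, hz, rfl⟩ <;>
  rcases exists_eq_pt_or_weyl (M := M) q with ⟨r', rfl⟩ | ⟨z', hz', rfl⟩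
  · rw [toProj_pt, toProj_pt, projRel_one_one, mem_maximalIdeal_iff, rel_iff_sub_mem]
  · rw [toProj_pt, toProj_weyl hz']
    refine iff_of_false (fun h => r.not_rel_inf (M.rel.trans h (rel_weyl_smul hz')))
      (not_projRel_one_max r (neg_mem (mem_maximalIdeal_iff.2 hz')))
  · rw [toProj_pt, toProj_weyl hz]
    refine iff_of_false
      (fun h => r'.not_rel_inf (M.rel.trans (M.rel.symm h) (rel_weyl_smul hz)))
      (fun h => not_projRel_one_max r' (neg_mem (mem_maximalIdeal_iff.2 hz))
        ((projRel M.Carrier).symm h))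
  · rw [toProj_weyl hz, toProj_weyl hz']
    exact iff_of_true (M.rel.trans (rel_weyl_smul hz) (M.rel.symm (rel_weyl_smul hz')))
      (projRel_max_max (neg_mem (mem_maximalIdeal_iff.2 hz)) (neg_mem (mem_maximalIdeal_iff.2 hz')))

theorem toProj_injective : Function.Injective M.toProj := by
  intro p q h
  have hrel : M.rel p q := (rel_iff_toProj p q).2 (h ▸ (projRel M.Carrier).refl _)
  rcases exists_eq_pt_or_weyl (M := M) p with ⟨r, rfl⟩ | ⟨z, hz, rfl⟩ <;>
  rcases exists_eq_pt_or_weyl (M := M) q with ⟨r', rfl⟩ | ⟨z', hz', rfl⟩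
  · rw [toProj_pt, toProj_pt, ProjLine.mk_eq_mk_iff] at h
    congr 1
    linear_combination -h
  · exact absurd (M.rel.trans hrel (rel_weyl_smul hz')) r.not_rel_inf
  · exact absurd (M.rel.trans (M.rel.symm hrel) (rel_weyl_smul hz)) r'.not_rel_inf
  · rw [toProj_weyl hz, toProj_weyl hz', ProjLine.mk_eq_mk_iff] at h
    have : z = z' := by linear_combination -h
    rw [this]

theorem toProj_surjective : Function.Surjective M.toProj := by
  intro p
  induction p using Quotient.inductionOn with | _ v =>
  obtain ⟨⟨a, b⟩, hab⟩ : ∃ q : M.Carrier × M.Carrier, v.1 = ![q.1, q.2] :=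
    ⟨(v.1 0, v.1 1), by ext i; fin_cases i <;> rfl⟩
  have hc : IsCoprime a b := by simpa [hab] using v.2
  have hv : (Quotient.mk (lineSetoid M.Carrier) v : ProjLine M.Carrier) = ProjLine.mk a b hc :=
    congrArg (Quotient.mk (lineSetoid M.Carrier)) (Subtype.ext hab)
  suffices h : ∃ x, M.toProj x = ProjLine.mk a b hc from h.imp fun x hx => hx.trans hv.symm
  by_cases ha : a ∈ M.nonunits
  · obtain ⟨s, t, hst⟩ := id hc
    -- If both coordinates were in the class of `0`, so would be `1`, by the Bézout relation.
    have hb : IsUnit b := isUnit_iff.2 fun hb => one_notMem (M := M) <| by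
      rw [← hst, mul_comm s, mul_comm t]
      exact add_mem (mul_mem_nonunits ha s) (mul_mem_nonunits hb t)
    obtain ⟨b', hb'⟩ := hb.exists_right_inv
    refine ⟨M.weyl • (-(a * b')).pt, ?_⟩
    rw [toProj_weyl (neg_mem (mul_mem_nonunits ha b')), ProjLine.mk_eq_mk_iff]
    linear_combination a * hb'
  · obtain ⟨a', ha'⟩ := (isUnit_iff.2 ha).exists_right_inv
    refine ⟨(a' * b).pt, ?_⟩
    rw [toProj_pt, ProjLine.mk_eq_mk_iff]
    linear_combination (-b) * ha'

/-! ### The generators as matrices -/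

theorem toProj_weyl_smul (p : X) :
    M.toProj (M.weyl • p) = lineMul (weylMatrix M.Carrier) (M.toProj p) := by
  rcases exists_eq_pt_or_weyl (M := M) p with ⟨r, rfl⟩ | ⟨z, hz, rfl⟩
  · by_cases hr : r ∈ M.nonunits
    · rw [toProj_weyl hr, toProj_pt, ProjLine.mk_eq_lineMul_weyl_iff]
      ring
    · rw [← pt_swapApp isSwap_weyl hr, toProj_pt, toProj_pt, ProjLine.mk_eq_lineMul_weyl_iff]
      linear_combination swapApp_weyl_mul hr
  · rw [weyl_smul_weyl_smul, toProj_pt, toProj_weyl hz, ProjLine.mk_eq_lineMul_weyl_iff]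
    ring

theorem α_smul_weyl_smul
    (h : ∀ x y, M.rel x M.zero → ¬ M.rel y M.inf →
      M.α y • M.weyl • x = M.weyl • M.Rmap (1 : M.Carrier).pt x
        (M.weyl • M.α (M.neg (M.add (1 : M.Carrier).pt (1 : M.Carrier).pt)) •
          M.Rmap (1 : M.Carrier).pt x y))
    {z : M.Carrier} (hz : z ∈ M.nonunits) (y : M.Carrier) :
    ∃ w, w * (1 - z * y) = 1 ∧ M.α y.pt • M.weyl • z.pt = M.weyl • (z * w).pt := by
  have hR : ∀ u : M.Carrier, M.Rmap (1 : M.Carrier).pt z.pt u.pt = (u * z + u * z).pt := fun u => by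
    rw [mul_add_mul, pt_REnd]
  -- The argument of the inner `μ_1` is `-2(1 - zy)`, a unit. Its image is `s = (2(1 - zy))⁻¹`, and
  -- the second `R_z` multiplies by `2z`; hence the witness `w = 2s`.
  have hc : y * z + y * z + -(1 + 1) ∉ M.nonunits := fun hc => one_sub_mul_notMem hz y <| by
    have e : y * z + y * z + -(1 + 1) = -((1 - z * y) + (1 - z * y)) := by ring
    rwa [e, neg_mem_iff, double_mem_iff] at hc
  have h1 := h z.pt y.pt hz y.not_rel_inf
  rw [hR, ← pt_add, ← pt_neg, α_smul_pt, ← pt_swapApp isSwap_weyl hc, hR] at h1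
  have hs := swapApp_weyl_mul hc
  set s := swapApp M.weyl (y * z + y * z + -(1 + 1))
  refine ⟨s + s, by linear_combination -hs, ?_⟩
  rw [h1, mul_add, mul_comm z]

theorem toProj_α_smul
    (h : ∀ z ∈ M.nonunits, ∀ y : M.Carrier,
      ∃ w, w * (1 - z * y) = 1 ∧ M.α y.pt • M.weyl • z.pt = M.weyl • (z * w).pt)
    (y : M.Carrier) (p : X) :
    M.toProj (M.α y.pt • p) = lineMul (upperUnipotent y) (M.toProj p) := by
  rcases exists_eq_pt_or_weyl (M := M) p with ⟨r, rfl⟩ | ⟨z, hz, rfl⟩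
  · rw [α_smul_pt, toProj_pt, toProj_pt, ProjLine.mk_eq_lineMul_upper_iff]
    ring
  · obtain ⟨w, hw, h1⟩ := h z hz y
    rw [h1, toProj_weyl (mul_mem_nonunits hz w), toProj_weyl hz, ProjLine.mk_eq_lineMul_upper_iff]
    -- The row `(-z, 1)` goes to `(-z, 1 - zy)`, which is proportional to `(-zw, 1)`.
    linear_combination (-z) * hw

theorem nonempty_iso_projMoufang
    (h : ∀ z ∈ M.nonunits, ∀ y : M.Carrier,
      ∃ w, w * (1 - z * y) = 1 ∧ M.α y.pt • M.weyl • z.pt = M.weyl • (z * w).pt) :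
    Nonempty (Iso M.toRootGroupData (projMoufang M.Carrier)) := by
  let φ : X ≃ ProjLine M.Carrier := Equiv.ofBijective M.toProj ⟨toProj_injective, toProj_surjective⟩
  have hφ : ∀ x y, M.rel x y ↔ projRel M.Carrier (φ x) (φ y) := rel_iff_toProj
  refine Iso.nonempty_of_map_eq _ _ φ hφ fun x => ?_
  have hα : ∀ y : M.Carrier, symRelCongr φ hφ (M.α y.pt) = pslPerm (upperUnipotent y) :=
    fun y => symRelCongr_eq φ hφ _ _ fun p => toProj_α_smul h y p
  have hw : symRelCongr φ hφ M.weyl = pslPerm (weylMatrix M.Carrier) :=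
    symRelCongr_eq φ hφ _ _ toProj_weyl_smul
  have hinf : φ M.inf = .mk 0 1 isCoprime_one_right := by
    have := toProj_weyl (M := M) (zero_mem _)
    rw [pt_zero, isSwap_weyl.smul_zero] at this
    refine this.trans ?_
    rw [ProjLine.mk_eq_mk_iff]
    ring
  have hU : (M.U M.inf).map (symRelCongr φ hφ).toMonoidHom = upperRootGroup M.Carrier := by
    ext g
    constructor
    · rintro ⟨g, hg, rfl⟩
      have hg0 := M.not_rel_smul hg M.zero_not_rel_inf
      exact ⟨.mk _ hg0, by rw [← hα, ← show g = M.α (Carrier.mk _ hg0).pt from eq_α hg rfl]; rfl⟩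
    · rintro ⟨r, rfl⟩
      exact ⟨_, α_mem r.not_rel_inf, hα r⟩
  have := map_U_eq φ hφ isSwap_weyl x
  rw [hU, hw, hinf] at this
  exact this

end PointedLocalMoufangSet

end LMS

end

theorem mainTheorem4 {X : Type*} (M : LMS.PointedLocalMoufangSet X)
    (t : X) (ht : M.IsUnitPoint t)
    -- (R1): special, where `∼` is computed with the fixed μ-map `τ = μ_t`
    (R1 : M.IsSpecial (M.mu t))
    -- (R2): `U_∞` is abelian
    (R2 : ∀ g ∈ M.U M.inf, ∀ h ∈ M.U M.inf, g * h = h * g)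
    -- (R3): the Hua subgroup is abelian
    (R3 : ∀ g ∈ M.huaSubgroup, ∀ h ∈ M.huaSubgroup, g * h = h * g)
    -- (R4): if `x` is a unit, then so is `x · 2 = x α_x`
    (R4 : ∀ x, M.IsUnitPoint x → M.IsUnitPoint (M.α x • x))
    (e : X) (he : M.IsUnitPoint e)
    -- `x μ_e α_y = y R_x α_{-2e} μ_e R_x μ_e` for all `x ∼ 0` and `y ≁ ∞`
    (hR : ∀ x y, M.rel x M.zero → ¬ M.rel y M.inf →
      M.α y • M.mu e • x =
        M.mu e • M.Rmap e x (M.mu e • M.α (M.neg (M.add e e)) • M.Rmap e x y)) :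
    -- the constructed ring structure on `R = X ∖ ∞̄` ...
    ∃ (_ : CommRing M.Carrier) (_ : IsLocalRing M.Carrier),
      (∀ x y : M.Carrier, (x + y).pt = M.add x.pt y.pt) ∧
      (∀ x y : M.Carrier, (x * y).pt = M.mul e x.pt y.pt) ∧
      (1 : M.Carrier).pt = e ∧
      -- ... and the isomorphism of `M` with `M(R)`
      Nonempty (LMS.Iso M.toRootGroupData (LMS.projMoufang M.Carrier)) := by
  open LMS.PointedLocalMoufangSet in
  have : M.IsSpecialAbelian := ⟨R2, fun x hx => inv_β_of_isSpecial ht R1 hx, R4⟩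
  let _ : M.AbelianHua := ⟨.mk e he.2, he.1, R3⟩
  exact ⟨inferInstance, inferInstance, pt_add, pt_mul, rfl,
    nonempty_iso_projMoufang fun z hz y => α_smul_weyl_smul hR hz y⟩
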